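/- **Conventions.** A real function $h$ is *regularly varying at infinity with index $\rho\in\mathbb R$*, written $h\in\mathrm{RV}_\infty(\rho)$, if on some half-line $[X,\infty)$ it is positive and measurable, and $\lim_{x\to\infty}h(\lambda x)/h(x)=\lambda^\rho$ for every $\lambda>0$. A function $f$ is *asymptotically increasing* if there is a nondecreasing $\varphi$ with $f(x)/\varphi(x)\to1$ as $x\to\infty$. **Theorem 2.1.** Let $\mu$ be a non-negative Borel measure on $[0,\infty)$ with $M(t):=\mu([0,t])<\infty$ for all $t\ge0$ and $\mu([0,\infty))=\infty$, and suppose $M\in\mathrm{RV}_\infty(\theta)$ with $\theta\ge0$. Let $f:(0,\infty)\to(0,\infty)$ be measurable with $1/f$ locally integrable on $(0,\infty)$ (for instance, $f$ continuous), and suppose $f\in\mathrm{RV}_\infty(\beta)$ with $\beta\in[0,1)$; when $\beta=0$ suppose in addition that $f$ is asymptotically increasing and $\lim_{u\to\infty}f(u)=\infty$. Let $\xi>0$ and let $x:[0,\infty)\to(0,\infty)$ be a solution of $$x'(t)=\int_{[0,t]}\mu(ds)\,f(x(t-s)),\quad t>0;\qquad x(0)=\xi,$$ that is, $x$ is locally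 absolutely continuous, $x(0)=\xi$, and for almost every $t>0$ the integral converges and the equation holds. Then $$x\in\mathrm{RV}_\infty\!\left(\frac{1+\theta}{1-\beta}\right)$$ and $$\lim_{t\to\infty}\frac{F(x(t))}{\bar M(t)}=\Lambda(\beta,\theta):=\frac{\Gamma(\theta+1)\,\Gamma\!\left(\frac{1+\beta\theta}{1-\beta}\right)}{\Gamma\!\left(\frac{1+\theta}{1-\beta}\right)},$$ where $F(u):=\int_1^u \frac{dv}{f(v)}$ for $u>0$, $\bar M(t):=\int_0^t M(s)\,ds$, and $\Gamma$ is Euler's Gamma function. -/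

import Mathlib

open Set Filter Topology MeasureTheory

noncomputable section

namespace VolterraRV

/-- `h` is regularly varying at infinity with index `ρ`: on some half-line `[X, ∞)` it is positive
and measurable, and `h (c x) / h x → c ^ ρ` as `x → ∞` for every `c > 0`. -/
def RegularlyVarying (h : ℝ → ℝ) (ρ : ℝ) : Prop :=
  (∃ X : ℝ, (∀ x ∈ Ici X, 0 < h x) ∧ Measurable ((Ici X).domRestrict h)) ∧
    ∀ c : ℝ, 0 < c → Tendsto (fun x => h (c * x) / h x) atTop (𝓝 (c ^ ρ))

/-- `f` is asymptotically increasing: it is asymptotically equivalent at infinity to a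
nondecreasing function. -/
def AsymptoticallyIncreasing (f : ℝ → ℝ) : Prop :=
  ∃ φ : ℝ → ℝ, Monotone φ ∧ Tendsto (fun x => f x / φ x) atTop (𝓝 1)

/-- `M(t) = μ[0,t]`. -/
def cumMass (μ : Measure ℝ) (t : ℝ) : ℝ := μ.real (Icc 0 t)

/-- `M̄(t) = ∫₀ᵗ M(s) ds`. -/
def cumMassIntegral (μ : Measure ℝ) (t : ℝ) : ℝ := ∫ s in (0 : ℝ)..t, cumMass μ s

/-- `F(x) = ∫₁ˣ du / f(u)`. -/
def bigF (f : ℝ → ℝ) (x : ℝ) : ℝ := ∫ u in (1 : ℝ)..x, 1 / f u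

/-- `Λ(β,θ) = Γ(θ+1) Γ((1+βθ)/(1-β)) / Γ((1+θ)/(1-β))`. -/
def Lam (β θ : ℝ) : ℝ :=
  Real.Gamma (θ + 1) * Real.Gamma ((1 + β * θ) / (1 - β)) / Real.Gamma ((1 + θ) / (1 - β))

/-- `x` is a (positive) solution on `[0, ∞)` of
`x'(t) = ∫_{[0,t]} μ(ds) f(x(t-s))`, `t > 0`, with `x(0) = ξ`: it is locally absolutely continuous
and satisfies the equation for almost every `t > 0`, the right-hand side being a convergent
integral. (If `μ` has an atom at `a > 0`, the right-hand side jumps at `t = a`, so the equation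
cannot hold at every `t`.) -/
structure IsSolution (μ : Measure ℝ) (f : ℝ → ℝ) (ξ : ℝ) (x : ℝ → ℝ) : Prop where
  init : x 0 = ξ
  pos : ∀ t : ℝ, 0 ≤ t → 0 < x t
  abs_cont : ∀ T : ℝ, 0 ≤ T → AbsolutelyContinuousOnInterval x 0 T
  eqn : ∀ᵐ t : ℝ, 0 < t →
    IntegrableOn (fun s => f (x (t - s))) (Icc 0 t) μ ∧
      HasDerivAt x (∫ s in Icc 0 t, f (x (t - s)) ∂μ) t

end VolterraRV

end

/-!
Integrating the equation and exchanging the integrals gives the convolution identity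
`x = ξ + M * (f ∘ x)`, from which `x` is nondecreasing and unbounded.

The function `f` is asymptotic to a monotone positive `φ`: this is assumed when `β = 0`, and follows
from the uniform convergence theorem for slowly varying functions when `β > 0`. Monotonicity of `φ`
and `M` makes regular variation easy to use, since dominated convergence then yields Karamata's
theorem `F(u) φ(u) / u → 1 / (1 - β)` and the convolution asymptotics
`(M * h)(t) ~ B(θ + 1, γ + 1) t M(t) h(t)` for monotone `h` of index `γ`.

The solution is compared with `a = F⁻¹ ∘ M̄`, which has index `ρ = (1 + θ) / (1 - β)` and satisfies
`t M(t) φ(a(t)) ~ ρ a(t)`. Hence `M * (φ ∘ a) ~ κ a` with `κ = ρ B(θ + 1, ρ β + 1) = Λ(β, θ)`.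
A Potter bound with an exponent below `1` shows that `x / a` stays between positive constants. If
`x ≤ K a` eventually, the convolution identity improves this to `x ≤ (κ K ^ β + o(1)) a`, and
similarly from below, so both the upper and the lower limit of `x / a` equal the fixed point
`κ ^ (1 / (1 - β))` (`IsConvolutionSolution.tendsto_div`). Since `F` has index `1 - β`, this gives
`F(x) / M̄ = F(x) / F(a) → κ`, and `x` inherits the index of `a`.
-/

namespace VolterraRV

/-! ### Regular variation and monotone equivalents -/

/-- The limit relation of regular variation with index `ρ` at infinity, without the positivity and
measurability requirements of `RegularlyVarying`. -/
def HasIndex (h : ℝ → ℝ) (ρ : ℝ) : Prop :=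
  ∀ c : ℝ, 0 < c → Tendsto (fun x => h (c * x) / h x) atTop (𝓝 (c ^ ρ))

/-- The uniform convergence theorem for slowly varying functions, in additive form. For large `t`
the set of shifts `v ∈ [0, 2]` moving `h t` by at least `ε / 2` has measure below `1 / 2`, and so
has the corresponding set for `t + u`; some `v ∈ [u, u + 1]` avoids both. -/
lemma eventually_forall_abs_shift_lt {h : ℝ → ℝ} (hm : Measurable h)
    (hlim : ∀ u, Tendsto (fun t => h (t + u) - h t) atTop (𝓝 0)) {ε : ℝ} (hε : 0 < ε) :
    ∀ᶠ t in atTop, ∀ u ∈ Icc (0 : ℝ) 1, |h (t + u) - h t| < ε := by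
  set E : ℝ → Set ℝ := fun t => {u | u ∈ Icc (0 : ℝ) 2 ∧ ε / 2 ≤ |h (t + u) - h t|} with hE
  have hEm : ∀ t, MeasurableSet (E t) := fun t =>
    measurableSet_Icc.inter (measurableSet_le measurable_const
      (show Measurable fun u => |h (t + u) - h t| by fun_prop))
  have hE0 : Tendsto (fun t => volume (E t)) atTop (𝓝 (volume (∅ : Set ℝ))) := by
    refine tendsto_measure_of_ae_tendsto_indicator atTop MeasurableSet.empty hEm
      (measurableSet_Icc (a := (0 : ℝ)) (b := 2)) (by simp) (Eventually.of_forall fun t u hu => hu.1)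
      (Eventually.of_forall fun u => ?_)
    have := (hlim u).abs
    rw [abs_zero] at this
    filter_upwards [this.eventually (gt_mem_nhds (half_pos hε))] with t ht
    simp only [mem_empty_iff_false, iff_false]
    exact fun hu => not_lt.2 hu.2 ht
  rw [measure_empty] at hE0
  obtain ⟨T, hT⟩ := eventually_atTop.1
    (hE0.eventually (gt_mem_nhds (show (0 : ENNReal) < 1 / 2 by simp)))
  filter_upwards [eventually_ge_atTop T] with t ht u hu
  by_contra! hcon
  have hsub : Icc u (u + 1) ⊆ E t ∪ (fun v => v - u) ⁻¹' E (t + u) := by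
    intro v hv
    by_contra hv'
    simp only [mem_union, not_or, mem_preimage, hE, mem_ofPred_eq, not_and, not_le] at hv'
    have h1 := hv'.1 ⟨by linarith [hu.1, hv.1], by linarith [hu.2, hv.2]⟩
    have h2 := hv'.2 ⟨by linarith [hv.1], by linarith [hv.2]⟩
    rw [show t + u + (v - u) = t + v by ring] at h2
    rw [abs_lt] at h1 h2
    have : |h (t + u) - h t| < ε := abs_lt.2 ⟨by linarith, by linarith⟩
    linarith
  have h1 : volume (Icc u (u + 1)) ≤ volume (E t) + volume (E (t + u)) := by
    refine (measure_mono hsub).trans ((measure_union_le _ _).trans_eq ?_)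
    simp_rw [sub_eq_add_neg]
    rw [measure_preimage_add_right]
  have h2 := ENNReal.add_lt_add (hT t ht) (hT (t + u) (by linarith [hu.1]))
  rw [ENNReal.add_halves] at h2
  have h3 : volume (Icc u (u + 1)) = 1 := by simp
  rw [h3] at h1
  exact absurd (h1.trans_lt h2) (lt_irrefl _)

/-- A function of positive index is almost increasing: `f p ≤ e^ε f q` for all large `p ≤ q`. -/
lemma HasIndex.eventually_forall_le {f : ℝ → ℝ} {β : ℝ} (hf : HasIndex f β) (hm : Measurable f)
    (hpos : ∀ u, 0 < u → 0 < f u) (hβ : 0 < β) {ε : ℝ} (hε : 0 < ε) :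
    ∀ᶠ p in atTop, ∀ q, p ≤ q → f p ≤ Real.exp ε * f q := by
  set k : ℝ → ℝ := fun t => Real.log (f (Real.exp t)) with hk
  have hlim : ∀ u, Tendsto (fun t => (k (t + u) - β * (t + u)) - (k t - β * t)) atTop (𝓝 0) := by
    intro u
    have h1 := ((hf (Real.exp u) (Real.exp_pos u)).comp Real.tendsto_exp_atTop).log
      (Real.rpow_pos_of_pos (Real.exp_pos u) _).ne'
    rw [Real.log_rpow (Real.exp_pos u), Real.log_exp] at h1
    have h2 := h1.sub_const (β * u)
    rw [sub_self] at h2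
    refine h2.congr fun t => ?_
    have e1 : Real.exp u * Real.exp t = Real.exp (t + u) := by rw [← Real.exp_add, add_comm]
    simp only [Function.comp, hk]
    rw [e1, Real.log_div (hpos _ (Real.exp_pos _)).ne' (hpos _ (Real.exp_pos _)).ne']
    ring
  set δ := min ε β with hδ
  have hδ0 : 0 < δ := lt_min hε hβ
  have hm' : Measurable (fun t => k t - β * t) := by fun_prop
  obtain ⟨T, hT⟩ := eventually_atTop.1 (eventually_forall_abs_shift_lt hm' hlim hδ0)
  -- each unit step costs at most `δ ≤ β`, which the linear term `β * t` pays for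
  have hstep : ∀ n : ℕ, ∀ t, T ≤ t → k t ≤ k (t + n) := by
    intro n
    induction n with
    | zero => intro t _; simp
    | succ n ih =>
      intro t ht
      have h1 := (abs_lt.1 (hT (t + n) (by have := n.cast_nonneg (α := ℝ); linarith) 1
        ⟨zero_le_one, le_rfl⟩)).1
      have h2 := min_le_right ε β
      have h3 := ih t ht
      push_cast
      rw [← add_assoc]
      nlinarith
  have hk' : ∀ t s, T ≤ t → 0 ≤ s → k t ≤ ε + k (t + s) := by
    intro t s ht hs
    have h1 := hstep ⌊s⌋₊ t ht
    have h2 := Nat.floor_le hs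
    have h3 := (Nat.lt_floor_add_one s).le
    have h4 := (abs_lt.1 (hT (t + ⌊s⌋₊) (by have := ⌊s⌋₊.cast_nonneg (α := ℝ); linarith)
      (s - ⌊s⌋₊) ⟨by linarith, by linarith⟩)).1
    have h5 := min_le_left ε β
    rw [show t + (⌊s⌋₊ : ℝ) + (s - ⌊s⌋₊) = t + s by ring] at h4
    have h6 : 0 ≤ β * (s - ⌊s⌋₊) := mul_nonneg hβ.le (by linarith)
    nlinarith
  filter_upwards [eventually_ge_atTop (Real.exp T)] with p hp q hpq
  have hp0 : 0 < p := (Real.exp_pos T).trans_le hp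
  have hq0 : 0 < q := hp0.trans_le hpq
  have h1 := hk' (Real.log p) (Real.log q - Real.log p) ((Real.le_log_iff_exp_le hp0).2 hp)
    (sub_nonneg.2 (Real.log_le_log hp0 hpq))
  rw [add_sub_cancel, hk] at h1
  simp only [Real.exp_log hp0, Real.exp_log hq0] at h1
  rw [← Real.log_le_log_iff (hpos p hp0) (mul_pos (Real.exp_pos _) (hpos q hq0)),
    Real.log_mul (Real.exp_pos _).ne' (hpos q hq0).ne', Real.log_exp]
  exact h1

/-- A function of positive index is asymptotic to `y ↦ inf_{u ≥ y} f u`. -/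
lemma HasIndex.asymptoticallyIncreasing {f : ℝ → ℝ} {β : ℝ} (hf : HasIndex f β)
    (hm : Measurable f) (hpos : ∀ u, 0 < u → 0 < f u) (hβ : 0 < β) :
    AsymptoticallyIncreasing f := by
  have hbdd : ∀ y : ℝ, BddBelow (f '' Ici (max y 1)) := fun y =>
    ⟨0, by
      rintro _ ⟨u, hu, rfl⟩
      exact (hpos u (one_pos.trans_le ((le_max_right _ _).trans hu))).le⟩
  have hne : ∀ y : ℝ, (f '' Ici (max y 1)).Nonempty := fun y => nonempty_Ici.image f
  set φ : ℝ → ℝ := fun y => sInf (f '' Ici (max y 1)) with hφ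
  have hle : ∀ y, 1 ≤ y → φ y ≤ f y := fun y hy =>
    csInf_le (hbdd y) ⟨y, by simp [hy], rfl⟩
  refine ⟨φ, fun y z hyz => csInf_le_csInf (hbdd y) (hne z)
    (image_mono (Ici_subset_Ici.2 (max_le_max_right _ hyz))), ?_⟩
  have hup : ∀ ε > 0, ∀ᶠ y in atTop, f y ≤ Real.exp ε * φ y := by
    intro ε hε
    filter_upwards [hf.eventually_forall_le hm hpos hβ hε, eventually_ge_atTop 1] with y hy hy1
    have : Real.exp (-ε) * f y ≤ φ y := by
      refine le_csInf (hne y) ?_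
      rintro _ ⟨u, hu, rfl⟩
      have := hy u ((le_max_left _ _).trans hu)
      calc Real.exp (-ε) * f y ≤ Real.exp (-ε) * (Real.exp ε * f u) := by gcongr
        _ = f u := by rw [← mul_assoc, ← Real.exp_add]; simp
    calc f y = Real.exp ε * (Real.exp (-ε) * f y) := by rw [← mul_assoc, ← Real.exp_add]; simp
      _ ≤ _ := by gcongr
  have hφpos : ∀ᶠ y in atTop, 0 < φ y := by
    filter_upwards [hup 1 one_pos, eventually_ge_atTop 1] with y hy hy1
    exact pos_of_mul_pos_right ((hpos y (by linarith)).trans_le hy) (Real.exp_pos _).le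
  refine tendsto_order.2 ⟨fun b hb => ?_, fun b hb => ?_⟩
  · filter_upwards [hφpos, eventually_ge_atTop 1] with y hy hy1
    exact hb.trans_le ((one_le_div hy).2 (hle y hy1))
  · have hlog : 0 < Real.log b := Real.log_pos hb
    filter_upwards [hφpos, hup _ (half_pos hlog)] with y hy hy1
    rw [div_lt_iff₀ hy]
    refine hy1.trans_lt (mul_lt_mul_of_pos_right ?_ hy)
    rw [← Real.lt_log_iff_exp_lt (by linarith)]
    linarith

/-- The monotone function asymptotic to a positive `f` can be taken positive everywhere. -/
lemma AsymptoticallyIncreasing.exists_pos {f : ℝ → ℝ} (hf : AsymptoticallyIncreasing f)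
    (hpos : ∀ u, 0 < u → 0 < f u) :
    ∃ φ : ℝ → ℝ, Monotone φ ∧ (∀ u, 0 < φ u) ∧ Tendsto (fun u => f u / φ u) atTop (𝓝 1) := by
  obtain ⟨φ, hmono, hlim⟩ := hf
  obtain ⟨X, hX⟩ := eventually_atTop.1 (hlim.eventually (lt_mem_nhds one_pos))
  refine ⟨fun u => φ (max u (max X 1)), fun u v huv => hmono (max_le_max_right _ huv),
    fun u => ?_, hlim.congr' ?_⟩
  · have h1 : 1 ≤ max u (max X 1) := (le_max_right _ _).trans (le_max_right _ _)
    have h2 := hX (max u (max X 1)) ((le_max_left _ _).trans (le_max_right _ _))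
    exact (div_pos_iff_of_pos_left (hpos _ (by linarith))).1 h2
  · filter_upwards [eventually_ge_atTop (max X 1)] with u hu
    rw [max_eq_left hu]

lemma HasIndex.congr {f g : ℝ → ℝ} {β l : ℝ} (hf : HasIndex f β) (hl : l ≠ 0)
    (hfg : Tendsto (fun u => f u / g u) atTop (𝓝 l)) (hpos : ∀ᶠ u in atTop, 0 < f u) :
    HasIndex g β := by
  intro c hc
  have hc' : Tendsto (fun u : ℝ => c * u) atTop atTop := tendsto_id.const_mul_atTop hc
  have h1 := ((hf c hc).mul hfg).div (hfg.comp hc') hl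
  rw [mul_div_cancel_right₀ _ hl] at h1
  refine h1.congr' ?_
  filter_upwards [hpos, hc'.eventually hpos] with u h1 h2
  simp only [Pi.div_apply, Function.comp]
  by_cases hg1 : g u = 0
  · simp [hg1]
  by_cases hg2 : g (c * u) = 0
  · simp [hg2]
  field_simp

/-- A Potter bound: for `b > β` the ratio `φ p / φ q` grows at most like `s ^ b` when
`p ≤ s * q`. -/
lemma HasIndex.exists_potter {φ : ℝ → ℝ} {β b : ℝ} (hφ : HasIndex φ β) (hmono : Monotone φ)
    (hpos : ∀ u, 0 < φ u) (hb0 : 0 ≤ b) (hb : β < b) :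
    ∃ X C : ℝ, 0 < X ∧ 1 ≤ C ∧ ∀ p q s, X ≤ q → 1 ≤ s → p ≤ s * q → φ p ≤ C * s ^ b * φ q := by
  have h2 : (2 : ℝ) ^ β < 2 ^ b := Real.rpow_lt_rpow_of_exponent_lt one_lt_two hb
  obtain ⟨X, hX⟩ := eventually_atTop.1 ((hφ 2 two_pos).eventually (gt_mem_nhds h2))
  have hstep : ∀ n : ℕ, ∀ q, max X 1 ≤ q → φ (2 ^ n * q) ≤ ((2 : ℝ) ^ b) ^ n * φ q := by
    intro n
    induction n with
    | zero => intro q _; simp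
    | succ n ih =>
      intro q hq
      have hq1 : 1 ≤ q := (le_max_right _ _).trans hq
      have hqn : q ≤ 2 ^ n * q := le_mul_of_one_le_left (by linarith) (one_le_pow₀ one_le_two)
      have h3 := hX (2 ^ n * q) (((le_max_left _ _).trans hq).trans hqn)
      rw [div_lt_iff₀ (hpos _)] at h3
      calc φ (2 ^ (n + 1) * q) = φ (2 * (2 ^ n * q)) := by ring_nf
        _ ≤ 2 ^ b * φ (2 ^ n * q) := h3.le
        _ ≤ 2 ^ b * (((2 : ℝ) ^ b) ^ n * φ q) := by gcongr; exact ih q hq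
        _ = _ := by ring
  refine ⟨max X 1, 2 ^ b, by positivity, Real.one_le_rpow one_le_two hb0,
    fun p q s hq hs hp => ?_⟩
  have hq1 : 1 ≤ q := (le_max_right _ _).trans hq
  obtain ⟨n, hn1, hn2⟩ := exists_nat_pow_near hs one_lt_two
  calc φ p ≤ φ (2 ^ (n + 1) * q) := hmono (hp.trans (by gcongr))
    _ ≤ ((2 : ℝ) ^ b) ^ (n + 1) * φ q := hstep _ q hq
    _ = 2 ^ b * ((2 : ℝ) ^ n) ^ b * φ q := by
      rw [pow_succ, ← Real.rpow_natCast ((2 : ℝ) ^ b) n, ← Real.rpow_mul two_pos.le,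
        mul_comm b, Real.rpow_mul two_pos.le, Real.rpow_natCast]; ring
    _ ≤ 2 ^ b * s ^ b * φ q := by have := (hpos q).le; gcongr

/-! ### Asymptotic ratios and Karamata-type theorems -/

/-- A monotone regularly varying function preserves asymptotic ratios; monotonicity takes the place
of uniformity in `c`. -/
lemma HasIndex.tendsto_comp_div {F : ℝ → ℝ} {α : ℝ} (hF : HasIndex F α)
    (hmono : MonotoneOn F (Ioi 0)) (hpos : ∀ᶠ u in atTop, 0 < F u) {p q : ℝ → ℝ} {l : ℝ}
    (hl : 0 < l) (hq : Tendsto q atTop atTop) (hpq : Tendsto (fun t => p t / q t) atTop (𝓝 l)) :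
    Tendsto (fun t => F (p t) / F (q t)) atTop (𝓝 (l ^ α)) := by
  have hcont : ContinuousAt (fun k : ℝ => k ^ α) l :=
    Real.continuousAt_rpow_const l α (Or.inl hl.ne')
  refine tendsto_order.2 ⟨fun b hb => ?_, fun b hb => ?_⟩
  · obtain ⟨k, ⟨hk1, hk0⟩, hk2⟩ := (((hcont.eventually (lt_mem_nhds hb)).and
      (lt_mem_nhds hl)).filter_mono nhdsWithin_le_nhds |>.and
        (self_mem_nhdsWithin (a := l) (s := Iio l))).exists
    filter_upwards [((hF k hk0).comp hq).eventually (lt_mem_nhds hk1), hq.eventually hpos,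
      hq.eventually_gt_atTop 0, hpq.eventually (lt_mem_nhds hk2)] with t h1 h2 h3 h4
    rw [lt_div_iff₀ h3] at h4
    have h5 : 0 < k * q t := mul_pos hk0 h3
    exact h1.trans_le (div_le_div_of_nonneg_right (hmono h5 (h5.trans h4) h4.le) h2.le)
  · obtain ⟨k, hk1, hk2⟩ := ((hcont.eventually (gt_mem_nhds hb)).filter_mono
      nhdsWithin_le_nhds |>.and (self_mem_nhdsWithin (a := l) (s := Ioi l))).exists
    have hk0 : 0 < k := hl.trans hk2
    filter_upwards [((hF k hk0).comp hq).eventually (gt_mem_nhds hk1), hq.eventually hpos,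
      hq.eventually_gt_atTop 0, hpq.eventually (gt_mem_nhds hk2),
      hpq.eventually (lt_mem_nhds hl)] with t h1 h2 h3 h4 h5
    rw [div_lt_iff₀ h3] at h4
    have h6 : 0 < p t := (div_pos_iff_of_pos_right h3).1 h5
    exact (div_le_div_of_nonneg_right (hmono h6 (h6.trans h4) h4.le) h2.le).trans_lt h1

/-- Monotone functions of positive index can be inverted at the level of asymptotic ratios. -/
lemma HasIndex.tendsto_div_of_comp {F : ℝ → ℝ} {α : ℝ} (hF : HasIndex F α) (hα : 0 < α)
    (hmono : MonotoneOn F (Ioi 0)) (hpos : ∀ᶠ u in atTop, 0 < F u) {p q : ℝ → ℝ} {l : ℝ}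
    (hl : 0 < l) (hq : Tendsto q atTop atTop) (hp : ∀ᶠ t in atTop, 0 < p t)
    (hpq : Tendsto (fun t => F (p t) / F (q t)) atTop (𝓝 l)) :
    Tendsto (fun t => p t / q t) atTop (𝓝 (l ^ (1 / α))) := by
  refine tendsto_order.2 ⟨fun b hb => ?_, fun b hb => ?_⟩
  · rcases le_or_gt b 0 with hb0 | hb0
    · filter_upwards [hp, hq.eventually_gt_atTop 0] with t h1 h2
      exact hb0.trans_lt (div_pos h1 h2)
    have hbl : b ^ α < l := by
      rwa [one_div, Real.lt_rpow_inv_iff_of_pos hb0.le hl.le hα] at hb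
    obtain ⟨m, hm1, hm2⟩ := exists_between hbl
    filter_upwards [((hF b hb0).comp hq).eventually (gt_mem_nhds hm1), hq.eventually hpos,
      hq.eventually_gt_atTop 0, hpq.eventually (lt_mem_nhds hm2), hp] with t h1 h2 h3 h4 h5
    have h6 : F (b * q t) < F (p t) := (div_lt_div_iff_of_pos_right h2).1 (h1.trans h4)
    rw [lt_div_iff₀ h3]
    by_contra! hcon
    exact absurd (hmono h5 (mul_pos hb0 h3) hcon) h6.not_ge
  · have hb0 : 0 < b := (Real.rpow_pos_of_pos hl _).trans hb
    have hbl : l < b ^ α := by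
      rwa [gt_iff_lt, one_div, Real.rpow_inv_lt_iff_of_pos hl.le hb0.le hα] at hb
    obtain ⟨m, hm1, hm2⟩ := exists_between hbl
    filter_upwards [((hF b hb0).comp hq).eventually (lt_mem_nhds hm2), hq.eventually hpos,
      hq.eventually_gt_atTop 0, hpq.eventually (gt_mem_nhds hm1), hp] with t h1 h2 h3 h4 h5
    have h6 : F (p t) < F (b * q t) := (div_lt_div_iff_of_pos_right h2).1 (h4.trans h1)
    rw [div_lt_iff₀ h3]
    by_contra! hcon
    exact absurd (hmono (mul_pos hb0 h3) h5 hcon) h6.not_ge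

lemma integral_rpow_mul_one_sub_rpow {γ θ : ℝ} (hγ : 0 ≤ γ) (hθ : 0 ≤ θ) :
    ∫ s in (0 : ℝ)..1, (1 - s) ^ θ * s ^ γ = ProbabilityTheory.beta (θ + 1) (γ + 1) := by
  have h1 := ProbabilityTheory.beta_eq_betaIntegralReal (γ + 1) (θ + 1) (by linarith) (by linarith)
  have h2 : ProbabilityTheory.beta (θ + 1) (γ + 1) = ProbabilityTheory.beta (γ + 1) (θ + 1) := by
    rw [ProbabilityTheory.beta, ProbabilityTheory.beta, mul_comm, add_comm (θ + 1)]
  have h3 : Complex.betaIntegral ((γ + 1 : ℝ) : ℂ) ((θ + 1 : ℝ) : ℂ)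
      = ((∫ s in (0 : ℝ)..1, (1 - s) ^ θ * s ^ γ : ℝ) : ℂ) := by
    rw [Complex.betaIntegral, ← intervalIntegral.integral_ofReal]
    refine intervalIntegral.integral_congr fun s hs => ?_
    rw [uIcc_of_le zero_le_one] at hs
    have : (0 : ℝ) ≤ 1 - s := by linarith [hs.2]
    rw [Complex.ofReal_mul, Complex.ofReal_cpow this, Complex.ofReal_cpow hs.1, mul_comm]
    push_cast
    ring_nf
  rw [h2, h1, h3, Complex.ofReal_re]

/-- The convolution of monotone regularly varying functions: rescaling to `[0, 1]` turns it into
a Beta integral, the rescaled integrand being bounded by `1` through monotonicity. -/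
lemma tendsto_convolution_div {M h : ℝ → ℝ} {θ γ : ℝ} (hMm : Monotone M) (hM0 : ∀ t, 0 ≤ M t)
    (hMpos : ∀ᶠ t in atTop, 0 < M t) (hM : HasIndex M θ) (hθ : 0 ≤ θ) (hhm : Monotone h)
    (hh0 : ∀ t, 0 < h t) (hh : HasIndex h γ) (hγ : 0 ≤ γ) :
    Tendsto (fun t => (∫ u in (0 : ℝ)..t, M (t - u) * h u) / (t * M t * h t)) atTop
      (𝓝 (ProbabilityTheory.beta (θ + 1) (γ + 1))) := by
  rw [← integral_rpow_mul_one_sub_rpow hγ hθ]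
  have key : Tendsto (fun t => ∫ s in (0 : ℝ)..1, M (t - t * s) * h (t * s) / (M t * h t)) atTop
      (𝓝 (∫ s in (0 : ℝ)..1, (1 - s) ^ θ * s ^ γ)) := by
    have hMme := hMm.measurable
    have hhme := hhm.measurable
    refine intervalIntegral.tendsto_integral_filter_of_dominated_convergence (fun _ => 1)
      (Eventually.of_forall fun t => by fun_prop) ?_ (by simp) ?_
    · filter_upwards [hMpos, eventually_gt_atTop 0] with t ht ht0
      refine Eventually.of_forall fun s hs => ?_
      rw [uIoc_of_le zero_le_one] at hs
      rw [Real.norm_of_nonneg (div_nonneg (mul_nonneg (hM0 _) (hh0 _).le)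
        (mul_pos ht (hh0 t)).le), div_le_one (mul_pos ht (hh0 t))]
      refine mul_le_mul (hMm ?_) (hhm ?_) (hh0 _).le ht.le
      · nlinarith [hs.1]
      · nlinarith [hs.2]
    · filter_upwards [compl_mem_ae_iff.2 (measure_singleton (μ := volume) (1 : ℝ))] with s hs1 hs
      rw [uIoc_of_le zero_le_one] at hs
      have hs2 : s < 1 := lt_of_le_of_ne hs.2 hs1
      refine ((hM (1 - s) (by linarith)).mul (hh s hs.1)).congr fun t => ?_
      rw [div_mul_div_comm, show (1 - s) * t = t - t * s by ring, mul_comm s t]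
  refine key.congr' ?_
  filter_upwards [eventually_gt_atTop 0, hMpos] with t ht hMt
  have h1 := intervalIntegral.integral_comp_mul_left (a := 0) (b := 1)
    (fun u => M (t - u) * h u) ht.ne'
  rw [mul_zero, mul_one, smul_eq_mul] at h1
  rw [intervalIntegral.integral_div, h1]
  have := (hh0 t).ne'
  field_simp

/-- A monotone function of index `β < 1` is sublinear. -/
lemma HasIndex.tendsto_div_self {φ : ℝ → ℝ} {β : ℝ} (hφ : HasIndex φ β) (hmono : Monotone φ)
    (hpos : ∀ u, 0 < φ u) (hβ0 : 0 ≤ β) (hβ : β < 1) :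
    Tendsto (fun u => φ u / u) atTop (𝓝 0) := by
  obtain ⟨X, C, hX, hC, hP⟩ := hφ.exists_potter (b := (β + 1) / 2) hmono hpos (by linarith)
    (by linarith)
  have h1 : Tendsto (fun u : ℝ => C * φ X / X * (u / X) ^ (-(1 - (β + 1) / 2))) atTop (𝓝 0) := by
    have := (tendsto_rpow_neg_atTop (y := 1 - (β + 1) / 2) (by linarith)).comp
      (tendsto_id.atTop_div_const hX)
    simpa using this.const_mul (C * φ X / X)
  refine squeeze_zero' ?_ ?_ h1
  · filter_upwards [eventually_gt_atTop 0] with u hu using div_nonneg (hpos u).le hu.le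
  · filter_upwards [eventually_ge_atTop X] with u hu
    have hu0 : 0 < u := hX.trans_le hu
    have h2 := hP u X (u / X) le_rfl ((one_le_div hX).2 hu) (by field_simp; rfl)
    rw [div_le_iff₀ hu0]
    refine h2.trans_eq ?_
    rw [show -(1 - (β + 1) / 2) = (β + 1) / 2 - 1 by ring, Real.rpow_sub_one (by positivity)]
    field_simp

/-- Karamata's theorem for `∫₁ᵘ dv / f v`, where `f` of index `β < 1` is asymptotic to the
monotone `φ`. -/
lemma tendsto_bigF_mul_div {f φ : ℝ → ℝ} {β : ℝ} (hf_meas : Measurable f)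
    (hf_pos : ∀ u, 0 < u → 0 < f u)
    (hf_int : ∀ u : ℝ, 0 < u → IntervalIntegrable (fun v => 1 / f v) volume 1 u)
    (hfφ : Tendsto (fun u => f u / φ u) atTop (𝓝 1)) (hφ : HasIndex φ β) (hmono : Monotone φ)
    (hpos : ∀ u, 0 < φ u) (hβ0 : 0 ≤ β) (hβ : β < 1) :
    Tendsto (fun u => bigF f u * (φ u / u)) atTop (𝓝 (1 / (1 - β))) := by
  obtain ⟨X, C, hX, hC, hP⟩ := hφ.exists_potter (b := (β + 1) / 2) hmono hpos (by linarith)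
    (by linarith)
  set b := (β + 1) / 2 with hb
  have hb1 : b < 1 := by linarith
  obtain ⟨T₀, hT₀⟩ := eventually_atTop.1 (hfφ.eventually (lt_mem_nhds one_half_lt_one))
  set T := max X T₀ with hT
  have hT0 : 0 < T := hX.trans_le (le_max_left _ _)
  have hfT : ∀ v, T ≤ v → φ v ≤ 2 * f v := fun v hv => by
    have := hT₀ v ((le_max_right _ _).trans hv)
    rw [lt_div_iff₀ (hpos v)] at this
    linarith
  -- only `v ≥ T` matters; there `f` is comparable to `φ`, and the Potter bound dominates the
  -- rescaled integrand by a multiple of `s ^ (-b)`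
  set k : ℝ → ℝ := (Ici T).indicator (fun v => 1 / f v) with hk
  have hkm : Measurable k := (measurable_const.div hf_meas).indicator measurableSet_Ici
  have key : Tendsto (fun u => ∫ s in (0 : ℝ)..1, φ u * k (u * s)) atTop
      (𝓝 (∫ s in (0 : ℝ)..1, s ^ (-β))) := by
    refine intervalIntegral.tendsto_integral_filter_of_dominated_convergence
      (fun s => 2 * C * s ^ (-b)) (Eventually.of_forall fun u =>
        (measurable_const.mul (hkm.comp (measurable_const_mul u))).aestronglyMeasurable) ?_
      ((intervalIntegral.intervalIntegrable_rpow' (by linarith)).const_mul _) ?_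
    · filter_upwards [eventually_gt_atTop 0] with u hu
      refine Eventually.of_forall fun s hs => ?_
      rw [uIoc_of_le zero_le_one] at hs
      have hs0 : 0 < s := hs.1
      by_cases hus : u * s ∈ Ici T
      · have hfp : 0 < f (u * s) := hf_pos _ (by positivity)
        rw [hk, indicator_of_mem hus, Real.norm_of_nonneg (mul_nonneg (hpos u).le (by positivity)),
          mul_one_div, div_le_iff₀ hfp]
        have h1 := hP u (u * s) s⁻¹ ((le_max_left _ _).trans hus) ((one_le_inv₀ hs0).2 hs.2)
          (by field_simp; rfl)
        rw [Real.inv_rpow hs0.le, ← Real.rpow_neg hs0.le] at h1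
        calc φ u ≤ C * s ^ (-b) * φ (u * s) := h1
          _ ≤ C * s ^ (-b) * (2 * f (u * s)) := by gcongr; exact hfT _ hus
          _ = _ := by ring
      · rw [hk, indicator_of_notMem hus, mul_zero, norm_zero]
        positivity
    · refine Eventually.of_forall fun s hs => ?_
      rw [uIoc_of_le zero_le_one] at hs
      have hs0 : 0 < s := hs.1
      have hsu : Tendsto (fun u : ℝ => s * u) atTop atTop := tendsto_id.const_mul_atTop hs0
      have h1 := ((hφ s hs0).mul (hfφ.comp hsu)).inv₀ (by
        rw [mul_one]; exact (Real.rpow_pos_of_pos hs0 _).ne')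
      rw [mul_one, ← Real.rpow_neg hs0.le] at h1
      refine h1.congr' ?_
      filter_upwards [hsu.eventually_ge_atTop T] with u hu
      have h2 : u * s ∈ Ici T := by rw [mul_comm]; exact hu
      rw [hk, indicator_of_mem h2, mul_comm u s]
      have := (hpos (s * u)).ne'
      simp only [Function.comp]
      field_simp
  have hval : ∫ s in (0 : ℝ)..1, s ^ (-β) = 1 / (1 - β) := by
    rw [integral_rpow (Or.inl (by linarith)), Real.one_rpow, Real.zero_rpow (by linarith)]
    rw [sub_zero, neg_add_eq_sub]
  rw [hval] at key
  have h0 := (hφ.tendsto_div_self hmono hpos hβ0 hβ).const_mul (bigF f T)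
  have h2 := h0.add key
  rw [mul_zero, zero_add] at h2
  refine h2.congr' ?_
  filter_upwards [eventually_ge_atTop T] with u hu
  have hu0 : 0 < u := hT0.trans_le hu
  have hint : IntervalIntegrable (fun v => 1 / f v) volume T u :=
    (hf_int T hT0).symm.trans (hf_int u hu0)
  have e1 : bigF f u = bigF f T + ∫ v in T..u, 1 / f v :=
    (intervalIntegral.integral_add_adjacent_intervals (hf_int T hT0) hint).symm
  have e2 : ∫ v in (0 : ℝ)..u, k v = ∫ v in T..u, 1 / f v := by
    rw [intervalIntegral.integral_of_le hu0.le, intervalIntegral.integral_of_le hu, hk,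
      setIntegral_indicator measurableSet_Ici, ← integral_Icc_eq_integral_Ioc]
    congr 2
    ext v
    simp only [mem_inter_iff, mem_Ioc, mem_Ici, mem_Icc]
    exact ⟨fun h => ⟨h.2, h.1.2⟩, fun h => ⟨⟨hT0.trans_le h.1, h.2⟩, h.1⟩⟩
  have e3 := intervalIntegral.integral_comp_mul_left (a := 0) (b := 1) k hu0.ne'
  rw [mul_zero, mul_one, smul_eq_mul, e2] at e3
  rw [intervalIntegral.integral_const_mul, e3, e1]
  field_simp

/-! ### The convolution identity for solutions -/

/-- `x = ξ + M * g` on `[0, ∞)`, where `M * g` is the convolution `∫₀ᵗ M(t - u) g(u) du` and `g` is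
nonnegative and locally integrable. -/
structure IsConvolutionSolution (M g : ℝ → ℝ) (ξ : ℝ) (x : ℝ → ℝ) : Prop where
  nonneg : ∀ u, 0 ≤ u → 0 ≤ g u
  integrable : ∀ T, 0 ≤ T → IntervalIntegrable g volume 0 T
  integrable_conv : ∀ T, 0 ≤ T → IntervalIntegrable (fun u => M (T - u) * g u) volume 0 T
  eqn : ∀ T, 0 ≤ T → x T = ξ + ∫ u in (0 : ℝ)..T, M (T - u) * g u

lemma cumMass_mono {μ : Measure ℝ} (hμ : ∀ t : ℝ, μ (Icc 0 t) < ⊤) : Monotone (cumMass μ) :=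
  fun _ _ hst => ENNReal.toReal_mono (hμ _).ne (measure_mono (Icc_subset_Icc_right hst))

lemma cumMass_nonneg (μ : Measure ℝ) (t : ℝ) : 0 ≤ cumMass μ t := ENNReal.toReal_nonneg

lemma tendsto_cumMass {μ : Measure ℝ} (hμ : ∀ t : ℝ, μ (Icc 0 t) < ⊤) (hμ_inf : μ (Ici 0) = ⊤) :
    Tendsto (cumMass μ) atTop atTop := by
  have h1 : Tendsto (fun t : ℝ => μ (Icc 0 t)) atTop (𝓝 ⊤) := by
    have := tendsto_measure_iUnion_atTop (μ := μ) (s := fun t : ℝ => Icc 0 t)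
      (fun s t hst => Icc_subset_Icc_right hst)
    rwa [iUnion_Icc_right, hμ_inf] at this
  refine tendsto_atTop.2 fun K => ?_
  filter_upwards [h1.eventually (lt_mem_nhds (ENNReal.ofReal_lt_top (r := K)))] with t ht
  exact (ENNReal.ofReal_le_iff_le_toReal (hμ t).ne).1 ht.le

namespace IsSolution

variable {μ : Measure ℝ} {f : ℝ → ℝ} {ξ : ℝ} {x : ℝ → ℝ}

lemma continuousOn (hx : IsSolution μ f ξ x) : ContinuousOn x (Ici 0) := by
  intro t ht
  have h1 := (hx.abs_cont (t + 1) (by linarith [mem_Ici.1 ht])).continuousOn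
  rw [uIcc_of_le (by linarith [mem_Ici.1 ht])] at h1
  refine (h1 t ⟨ht, by linarith⟩).mono_of_mem_nhdsWithin ?_
  rw [← Ici_inter_Iic]
  exact inter_mem_nhdsWithin _ (Iic_mem_nhds (by linarith))

lemma ae_deriv_nonneg (hx : IsSolution μ f ξ x) (hf_pos : ∀ u, 0 < u → 0 < f u) :
    ∀ᵐ t : ℝ, 0 < t → 0 ≤ deriv x t := by
  filter_upwards [hx.eqn] with t ht ht0
  rw [(ht ht0).2.deriv]
  exact setIntegral_nonneg measurableSet_Icc fun s hs =>
    (hf_pos _ (hx.pos _ (sub_nonneg.2 hs.2))).le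

lemma monotoneOn (hx : IsSolution μ f ξ x) (hf_pos : ∀ u, 0 < u → 0 < f u) :
    MonotoneOn x (Ici 0) := by
  intro s hs t ht hst
  have hs : 0 ≤ s := hs
  have h1 := ((hx.abs_cont t ht).mono (c := s) (d := t) (by
    rw [uIcc_of_le hst, uIcc_of_le (hs.trans hst)]
    exact Icc_subset_Icc_left hs)).integral_deriv_eq_sub
  have h2 : 0 ≤ ∫ u in s..t, deriv x u := by
    rw [intervalIntegral.integral_of_le hst]
    refine setIntegral_nonneg_of_ae_restrict ?_
    filter_upwards [ae_restrict_of_ae (hx.ae_deriv_nonneg hf_pos),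
      ae_restrict_mem measurableSet_Ioc] with u hu hu'
    exact hu (hs.trans_lt hu'.1)
  linarith

/-- Integrating the equation over `[0, T]` and applying Tonelli's theorem. -/
lemma ofReal_sub_eq_lintegral (hx : IsSolution μ f ξ x) (hμ : ∀ t : ℝ, μ (Icc 0 t) < ⊤)
    (hf_meas : Measurable f) (hf_pos : ∀ u, 0 < u → 0 < f u) {T : ℝ} (hT : 0 ≤ T) :
    ENNReal.ofReal (x T - ξ) =
      ∫⁻ u in Icc 0 T, ENNReal.ofReal (f (x u)) * μ (Icc 0 (T - u)) := by
  set G : ℝ → ENNReal := (Ici 0).indicator fun u => ENNReal.ofReal (f (x (max u 0))) with hG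
  have hGm : Measurable G := by
    have h1 : Continuous fun u : ℝ => x (max u 0) :=
      hx.continuousOn.comp_continuous (by fun_prop) fun u => mem_Ici.2 (le_max_right u 0)
    exact (hf_meas.comp h1.measurable).ennreal_ofReal.indicator measurableSet_Ici
  have hGpos : ∀ u, 0 ≤ u → G u = ENNReal.ofReal (f (x u)) := fun u hu => by
    rw [hG, indicator_of_mem (mem_Ici.2 hu), max_eq_left hu]
  have hGneg : ∀ u, u < 0 → G u = 0 := fun u hu =>
    indicator_of_notMem (by simpa using hu) _
  have : IsFiniteMeasure (μ.restrict (Icc 0 T)) :=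
    ⟨by rw [Measure.restrict_apply_univ]; exact hμ T⟩
  have hderiv : ∀ᵐ t ∂(volume.restrict (Ioc 0 T)), ENNReal.ofReal (deriv x t)
      = ∫⁻ s in Icc 0 T, G (t - s) ∂μ := by
    filter_upwards [ae_restrict_of_ae hx.eqn, ae_restrict_mem measurableSet_Ioc] with t ht htT
    obtain ⟨h1, h2⟩ := ht htT.1
    rw [h2.deriv, ofReal_integral_eq_lintegral_ofReal h1]
    · have e1 : ∀ s ∈ Icc 0 T, G (t - s)
          = (Iic t).indicator (fun s => ENNReal.ofReal (f (x (t - s)))) s := by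
        intro s _
        rcases le_or_gt s t with hs | hs
        · rw [indicator_of_mem (mem_Iic.2 hs), hGpos _ (sub_nonneg.2 hs)]
        · rw [indicator_of_notMem (by simpa using hs), hGneg _ (sub_neg.2 hs)]
      rw [setLIntegral_congr_fun measurableSet_Icc e1, setLIntegral_indicator measurableSet_Iic]
      congr 2
      ext s
      simp only [mem_Icc, mem_inter_iff, mem_Iic]
      exact ⟨fun h => ⟨h.2, h.1, h.2.trans htT.2⟩, fun h => ⟨h.2.1, h.1⟩⟩
    · filter_upwards [ae_restrict_mem measurableSet_Icc] with s hs
      exact (hf_pos _ (hx.pos _ (sub_nonneg.2 hs.2))).le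
  have hac := hx.abs_cont T hT
  have hI : IntegrableOn (deriv x) (Ioc 0 T) :=
    (intervalIntegrable_iff_integrableOn_Ioc_of_le hT).1 hac.intervalIntegrable_deriv
  have hL : ENNReal.ofReal (x T - ξ) = ∫⁻ t in Icc 0 T, ∫⁻ s in Icc 0 T, G (t - s) ∂μ := by
    rw [← hx.init, ← hac.integral_deriv_eq_sub, intervalIntegral.integral_of_le hT,
      ofReal_integral_eq_lintegral_ofReal hI, lintegral_congr_ae hderiv,
      setLIntegral_congr Ioc_ae_eq_Icc]
    filter_upwards [ae_restrict_of_ae (hx.ae_deriv_nonneg hf_pos),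
      ae_restrict_mem measurableSet_Ioc] with u hu hu'
    exact hu hu'.1
  have hshift : ∀ s, ∫⁻ t in Icc 0 T, G (t - s)
      = ∫⁻ u, (Icc 0 T).indicator (fun _ => G u) (u + s) := by
    intro s
    rw [← lintegral_indicator measurableSet_Icc,
      ← lintegral_sub_right_eq_self (fun u => (Icc 0 T).indicator (fun _ => G u) (u + s)) s]
    refine lintegral_congr fun t => ?_
    rw [sub_add_cancel]
    rfl
  have hm : Measurable fun p : ℝ × ℝ => (Icc 0 T).indicator (fun _ => G p.2) (p.2 + p.1) := by
    have : (fun p : ℝ × ℝ => (Icc 0 T).indicator (fun _ => G p.2) (p.2 + p.1))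
        = ((fun p : ℝ × ℝ => p.2 + p.1) ⁻¹' Icc 0 T).indicator fun p => G p.2 := rfl
    rw [this]
    exact (hGm.comp measurable_snd).indicator
      ((measurable_snd.add measurable_fst) measurableSet_Icc)
  rw [hL, lintegral_lintegral_swap (by fun_prop)]
  simp_rw [hshift]
  rw [lintegral_lintegral_swap hm.aemeasurable, ← lintegral_indicator measurableSet_Icc]
  refine lintegral_congr fun u => ?_
  rcases lt_or_ge u 0 with hu | hu
  · rw [indicator_of_notMem (by simp [hu])]
    simp [hGneg u hu]
  have e2 : ∫⁻ s in Icc 0 T, (Icc 0 T).indicator (fun _ => G u) (u + s) ∂μ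
      = G u * μ (Icc 0 (T - u)) := by
    have e3 : (fun s => (Icc 0 T).indicator (fun _ => G u) (u + s))
        = ((fun s => u + s) ⁻¹' Icc 0 T).indicator fun _ => G u := rfl
    rw [e3, setLIntegral_indicator (measurable_const_add u measurableSet_Icc), setLIntegral_const]
    congr 2
    ext s
    simp only [mem_inter_iff, mem_preimage, mem_Icc]
    exact ⟨fun h => ⟨h.2.1, by linarith [h.1.2]⟩,
      fun h => ⟨⟨by linarith [h.1], by linarith [h.2]⟩, h.1, by linarith [h.2]⟩⟩
  rw [e2, hGpos u hu]
  rcases le_or_gt u T with huT | huT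
  · rw [indicator_of_mem (mem_Icc.2 ⟨hu, huT⟩)]
  · rw [indicator_of_notMem (by simp [huT]), Icc_eq_empty (by linarith)]
    simp

/-- A solution of the delay equation satisfies `x = ξ + M * (f ∘ x)`. -/
lemma isConvolutionSolution (hx : IsSolution μ f ξ x) (hμ : ∀ t : ℝ, μ (Icc 0 t) < ⊤)
    (hμ_inf : μ (Ici 0) = ⊤) (hf_meas : Measurable f) (hf_pos : ∀ u, 0 < u → 0 < f u) :
    IsConvolutionSolution (cumMass μ) (fun u => f (x u)) ξ x := by
  have hMm := cumMass_mono hμ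
  have hg0 : ∀ u, 0 ≤ u → 0 ≤ f (x u) := fun u hu => (hf_pos _ (hx.pos u hu)).le
  have hgm : ∀ T, AEMeasurable (fun u => f (x u)) (volume.restrict (Icc 0 T)) := fun T =>
    hf_meas.comp_aemeasurable
      ((hx.continuousOn.mono Icc_subset_Ici_self).aemeasurable measurableSet_Icc)
  have hcm : ∀ T, AEStronglyMeasurable (fun u => cumMass μ (T - u) * f (x u))
      (volume.restrict (Icc 0 T)) := fun T =>
    ((hMm.measurable.comp (measurable_const.sub measurable_id)).aemeasurable.mul
      (hgm T)).aestronglyMeasurable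
  have hc0 : ∀ T, 0 ≤ᵐ[volume.restrict (Icc 0 T)] fun u => cumMass μ (T - u) * f (x u) := by
    intro T
    filter_upwards [ae_restrict_mem measurableSet_Icc] with u hu
    exact mul_nonneg (cumMass_nonneg _ _) (hg0 u hu.1)
  have hlin : ∀ T, 0 ≤ T → ∫⁻ u in Icc 0 T, ENNReal.ofReal (cumMass μ (T - u) * f (x u))
      = ENNReal.ofReal (x T - ξ) := by
    intro T hT
    rw [hx.ofReal_sub_eq_lintegral hμ hf_meas hf_pos hT]
    refine lintegral_congr fun u => ?_
    rw [ENNReal.ofReal_mul (cumMass_nonneg _ _), cumMass, ofReal_measureReal (hμ _).ne, mul_comm]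
  have hint : ∀ T, 0 ≤ T → IntegrableOn (fun u => cumMass μ (T - u) * f (x u)) (Icc 0 T) := by
    intro T hT
    refine ⟨hcm T, ?_⟩
    rw [hasFiniteIntegral_iff_ofReal (hc0 T), hlin T hT]
    exact ENNReal.ofReal_lt_top
  refine ⟨hg0, fun T hT => ?_, fun T hT => ?_, fun T hT => ?_⟩
  · -- integrability of `f ∘ x` on `[0, T]` comes from that of `M(T + t₁ - u) f (x u)`, since
    -- `M(T + t₁ - u) ≥ M(t₁) > 0` there
    obtain ⟨t₁, ht₁, ht₁0⟩ := ((tendsto_cumMass hμ hμ_inf).eventually_gt_atTop 0 |>.and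
      (eventually_ge_atTop 0)).exists
    rw [intervalIntegrable_iff_integrableOn_Icc_of_le hT]
    have h1 := ((hint (T + t₁) (by linarith)).mono_set
      (Icc_subset_Icc_right (by linarith : T ≤ T + t₁))).div_const (cumMass μ t₁)
    refine Integrable.mono' h1 (hgm T).aestronglyMeasurable ?_
    filter_upwards [ae_restrict_mem measurableSet_Icc] with u hu
    rw [Real.norm_of_nonneg (hg0 u hu.1), le_div_iff₀ ht₁, mul_comm]
    exact mul_le_mul_of_nonneg_right (hMm (by linarith [hu.2])) (hg0 u hu.1)
  · exact (intervalIntegrable_iff_integrableOn_Icc_of_le hT).2 (hint T hT)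
  · have h0 : ξ ≤ x T := by
      rw [← hx.init]
      exact hx.monotoneOn hf_pos self_mem_Ici hT hT
    have h1 := ofReal_integral_eq_lintegral_ofReal (hint T hT) (hc0 T)
    rw [hlin T hT, ENNReal.ofReal_eq_ofReal_iff (integral_nonneg_of_ae (hc0 T))
      (sub_nonneg.2 h0)] at h1
    rw [intervalIntegral.integral_of_le hT, ← integral_Icc_eq_integral_Ioc, h1]
    ring

/-- Solutions are unbounded, because `x t ≥ M(t - 1) ∫₀¹ f (x u) du`. -/
lemma tendsto_atTop (hx : IsSolution μ f ξ x) (hμ : ∀ t : ℝ, μ (Icc 0 t) < ⊤)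
    (hμ_inf : μ (Ici 0) = ⊤) (hf_meas : Measurable f) (hf_pos : ∀ u, 0 < u → 0 < f u)
    (hξ : 0 < ξ) : Tendsto x atTop atTop := by
  have hc := hx.isConvolutionSolution hμ hμ_inf hf_meas hf_pos
  have hM := cumMass_mono hμ
  have hI : 0 < ∫ u in (0 : ℝ)..1, f (x u) :=
    intervalIntegral.intervalIntegral_pos_of_pos_on (hc.integrable 1 zero_le_one)
      (fun u hu => hf_pos _ (hx.pos u hu.1.le)) zero_lt_one
  have h1 : Tendsto (fun t => cumMass μ (t - 1) * ∫ u in (0 : ℝ)..1, f (x u)) atTop atTop :=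
    ((tendsto_cumMass hμ hμ_inf).comp
      (tendsto_atTop_add_const_right _ (-1) tendsto_id)).atTop_mul_const hI
  refine tendsto_atTop_mono' _ ?_ h1
  filter_upwards [eventually_ge_atTop 1] with t ht
  have ht0 : 0 ≤ t := by linarith
  have hci := hc.integrable_conv t ht0
  have hci1 : IntervalIntegrable (fun u => cumMass μ (t - u) * f (x u)) volume 0 1 :=
    hci.mono_set (by
      rw [uIcc_of_le zero_le_one, uIcc_of_le ht0]
      exact Icc_subset_Icc_right ht)
  have e1 : ∫ u in (0 : ℝ)..1, cumMass μ (t - u) * f (x u)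
      ≤ ∫ u in (0 : ℝ)..t, cumMass μ (t - u) * f (x u) := by
    refine intervalIntegral.integral_mono_interval le_rfl zero_le_one ht ?_ hci
    filter_upwards [ae_restrict_mem measurableSet_Ioc] with u hu
    exact mul_nonneg (cumMass_nonneg _ _) (hc.nonneg u hu.1.le)
  have e2 : cumMass μ (t - 1) * ∫ u in (0 : ℝ)..1, f (x u)
      ≤ ∫ u in (0 : ℝ)..1, cumMass μ (t - u) * f (x u) := by
    rw [← intervalIntegral.integral_const_mul]
    refine intervalIntegral.integral_mono_on zero_le_one
      ((hc.integrable 1 zero_le_one).const_mul _) hci1 fun u hu => ?_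
    exact mul_le_mul_of_nonneg_right (hM (by linarith [hu.2])) (hc.nonneg u hu.1)
  rw [hc.eqn t ht0]
  linarith

end IsSolution

/-! ### Comparison estimates -/

lemma intervalIntegrable_conv_of_monotone {M h : ℝ → ℝ} (hM : Monotone M) (hh : Monotone h)
    (t a b : ℝ) : IntervalIntegrable (fun u => M (t - u) * h u) volume a b := by
  have h1 : Antitone fun u => M (t - u) := fun u v huv => hM (by linarith)
  rw [intervalIntegrable_iff]
  refine Integrable.mul_bdd (c := max |h a| |h b|)
    (intervalIntegrable_iff.1 h1.intervalIntegrable) hh.measurable.aestronglyMeasurable ?_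
  filter_upwards [ae_restrict_mem measurableSet_uIoc] with u hu
  have hu' : u ∈ uIcc a b := uIoc_subset_uIcc hu
  rcases le_total a b with hab | hab
  · rw [uIcc_of_le hab] at hu'
    exact abs_le_max_abs_abs (hh hu'.1) (hh hu'.2)
  · rw [uIcc_of_ge hab] at hu'
    rw [max_comm]
    exact abs_le_max_abs_abs (hh hu'.1) (hh hu'.2)

namespace IsConvolutionSolution

variable {M g h x : ℝ → ℝ} {ξ : ℝ}

/-- Upper comparison: replace `g` by `K h` after time `T`, and `M (t - u)` by `M t` before. -/
lemma le_of_forall_le (hx : IsConvolutionSolution M g ξ x) (hM : Monotone M) (hM0 : ∀ t, 0 ≤ M t)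
    (hh : Monotone h) (hh0 : ∀ t, 0 < h t) {T t K : ℝ} (hT : 0 ≤ T) (hTt : T ≤ t) (hK0 : 0 ≤ K)
    (hK : ∀ u ∈ Icc T t, g u ≤ K * h u) :
    x t ≤ ξ + M t * (∫ u in (0 : ℝ)..T, g u) + K * ∫ u in (0 : ℝ)..t, M (t - u) * h u := by
  have ht := hT.trans hTt
  have hc := hx.integrable_conv t ht
  have hc1 : IntervalIntegrable (fun u => M (t - u) * g u) volume 0 T := hc.mono_set (by
    rw [uIcc_of_le hT, uIcc_of_le ht]; exact Icc_subset_Icc_right hTt)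
  have hc2 : IntervalIntegrable (fun u => M (t - u) * g u) volume T t := hc.mono_set (by
    rw [uIcc_of_le hTt, uIcc_of_le ht]; exact Icc_subset_Icc_left hT)
  have hci := intervalIntegrable_conv_of_monotone hM hh t
  have e1 : ∫ u in (0 : ℝ)..T, M (t - u) * g u ≤ M t * ∫ u in (0 : ℝ)..T, g u := by
    rw [← intervalIntegral.integral_const_mul]
    refine intervalIntegral.integral_mono_on hT hc1 ((hx.integrable T hT).const_mul _)
      fun u hu => ?_
    exact mul_le_mul_of_nonneg_right (hM (by linarith [hu.1])) (hx.nonneg u hu.1)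
  have e2 : ∫ u in T..t, M (t - u) * g u ≤ K * ∫ u in T..t, M (t - u) * h u := by
    rw [← intervalIntegral.integral_const_mul]
    refine intervalIntegral.integral_mono_on hTt hc2 ((hci T t).const_mul _) fun u hu => ?_
    rw [mul_left_comm]
    exact mul_le_mul_of_nonneg_left (hK u hu) (hM0 _)
  have e3 : ∫ u in T..t, M (t - u) * h u ≤ ∫ u in (0 : ℝ)..t, M (t - u) * h u := by
    refine intervalIntegral.integral_mono_interval hT hTt le_rfl ?_ (hci 0 t)
    exact Eventually.of_forall fun u => mul_nonneg (hM0 _) (hh0 u).le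
  rw [hx.eqn t ht, ← intervalIntegral.integral_add_adjacent_intervals hc1 hc2]
  have := mul_le_mul_of_nonneg_left e3 hK0
  linarith

/-- Lower comparison: discard the contribution of `[0, T]` and replace `g` by `k h` after `T`. -/
lemma le_of_forall_ge (hx : IsConvolutionSolution M g ξ x) (hξ : 0 ≤ ξ) (hM : Monotone M)
    (hM0 : ∀ t, 0 ≤ M t) (hh : Monotone h) (hh0 : ∀ t, 0 < h t) {T t k : ℝ} (hT : 0 ≤ T)
    (hTt : T ≤ t) (hk0 : 0 ≤ k) (hk : ∀ u ∈ Icc T t, k * h u ≤ g u) :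
    k * ((∫ u in (0 : ℝ)..t, M (t - u) * h u) - M t * (T * h T)) ≤ x t := by
  have ht := hT.trans hTt
  have hc := hx.integrable_conv t ht
  have hc2 : IntervalIntegrable (fun u => M (t - u) * g u) volume T t := hc.mono_set (by
    rw [uIcc_of_le hTt, uIcc_of_le ht]; exact Icc_subset_Icc_left hT)
  have hci := intervalIntegrable_conv_of_monotone hM hh t
  have e1 : ∫ u in (0 : ℝ)..T, M (t - u) * h u ≤ M t * (T * h T) := by
    have := intervalIntegral.integral_mono_on (g := fun _ => M t * h T) hT (hci 0 T) (by simp)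
      fun u hu => mul_le_mul (hM (by linarith [hu.1])) (hh hu.2) (hh0 u).le (hM0 t)
    refine this.trans_eq ?_
    rw [intervalIntegral.integral_const, smul_eq_mul]
    ring
  have e2 : k * ∫ u in T..t, M (t - u) * h u ≤ ∫ u in T..t, M (t - u) * g u := by
    rw [← intervalIntegral.integral_const_mul]
    refine intervalIntegral.integral_mono_on hTt ((hci T t).const_mul _) hc2 fun u hu => ?_
    rw [mul_left_comm]
    exact mul_le_mul_of_nonneg_left (hk u hu) (hM0 _)
  have e3 : ∫ u in T..t, M (t - u) * g u ≤ ∫ u in (0 : ℝ)..t, M (t - u) * g u := by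
    refine intervalIntegral.integral_mono_interval hT hTt le_rfl ?_ hc
    filter_upwards [ae_restrict_mem measurableSet_Ioc] with u hu
    exact mul_nonneg (hM0 _) (hx.nonneg u hu.1.le)
  have e4 := intervalIntegral.integral_add_adjacent_intervals (hci 0 T) (hci T t)
  rw [hx.eqn t ht, ← e4]
  have := mul_le_mul_of_nonneg_left e1 hk0
  linarith

end IsConvolutionSolution

/-! ### Limits from self-improving bounds -/

/-- A function that is bounded by `A + B s ^ b`, `b < 1`, as long as its past is bounded by `s`,
is bounded: its running supremum `S` satisfies `S ≤ A + B S ^ b`. -/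
lemma exists_bound_of_self_bound {y : ℝ → ℝ} {T A B b : ℝ} (hb : b < 1)
    (hloc : ∀ t, ∃ K, ∀ u ∈ Icc T t, y u ≤ K)
    (hy : ∀ᶠ t in atTop, ∀ s, 1 ≤ s → (∀ u ∈ Icc T t, y u ≤ s) → y t ≤ A + B * s ^ b) :
    ∃ K, ∀ t, T ≤ t → y t ≤ K := by
  have hlim : Tendsto (fun s : ℝ => A * s⁻¹ + B * s ^ (-(1 - b))) atTop (𝓝 0) := by
    simpa using (tendsto_inv_atTop_zero.const_mul A).add
      ((tendsto_rpow_neg_atTop (sub_pos.2 hb)).const_mul B)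
  obtain ⟨K₀, hK₀⟩ := eventually_atTop.1 (hlim.eventually (gt_mem_nhds one_pos))
  obtain ⟨T', hT'⟩ := eventually_atTop.1 hy
  obtain ⟨K₁, hK₁⟩ := hloc T'
  refine ⟨max (max K₀ 1) K₁, fun t ht => ?_⟩
  by_contra! hcon
  obtain ⟨K₂, hK₂⟩ := hloc t
  have hbdd : BddAbove (y '' Icc T t) := ⟨K₂, by rintro _ ⟨u, hu, rfl⟩; exact hK₂ u hu⟩
  have hne : (y '' Icc T t).Nonempty := ⟨_, t, ⟨ht, le_rfl⟩, rfl⟩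
  set S := sSup (y '' Icc T t) with hS
  have hle : ∀ u ∈ Icc T t, y u ≤ S := fun u hu => le_csSup hbdd ⟨u, hu, rfl⟩
  have hSt : max (max K₀ 1) K₁ < S := hcon.trans_le (hle t ⟨ht, le_rfl⟩)
  have hSK₀ : K₀ < S := ((le_max_left _ _).trans (le_max_left _ _)).trans_lt hSt
  have hS1 : 1 < S := ((le_max_right _ _).trans (le_max_left _ _)).trans_lt hSt
  have hSK₁ : K₁ < S := (le_max_right _ _).trans_lt hSt
  have hS0 : 0 < S := one_pos.trans hS1
  have h1 : A + B * S ^ b < S := by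
    have h2 := hK₀ S hSK₀.le
    rw [show -(1 - b) = b - 1 by ring, Real.rpow_sub_one hS0.ne'] at h2
    have h3 : A * S⁻¹ + B * (S ^ b / S) = (A + B * S ^ b) / S := by field_simp
    rwa [h3, div_lt_one hS0] at h2
  have h2 : S ≤ max K₁ (A + B * S ^ b) := by
    refine csSup_le hne ?_
    rintro _ ⟨u, hu, rfl⟩
    rcases le_total u T' with h | h
    · exact (hK₁ u ⟨hu.1, h⟩).trans (le_max_left _ _)
    · exact (hT' u h S hS1.le fun v hv => hle v ⟨hv.1, hv.2.trans hu.2⟩).trans (le_max_right _ _)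
  exact absurd (max_lt hSK₁ h1) h2.not_gt

/-- If asymptotic bounds for `y` improve under `K ↦ κ K ^ β` with `β < 1`, then `y` tends to the
positive fixed point `κ ^ (1 / (1 - β))` of this map. -/
lemma tendsto_of_bound_improvement {y : ℝ → ℝ} {κ β c C : ℝ} (hβ : β < 1) (hκ : 0 < κ)
    (hc : 0 < c) (hcy : ∀ᶠ t in atTop, c ≤ y t) (hyC : ∀ᶠ t in atTop, y t ≤ C)
    (hU : ∀ K, 0 < K → (∀ᶠ t in atTop, y t ≤ K) → ∀ B, κ * K ^ β < B → ∀ᶠ t in atTop, y t ≤ B)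
    (hL : ∀ k, 0 < k → (∀ᶠ t in atTop, k ≤ y t) → ∀ B, B < κ * k ^ β → ∀ᶠ t in atTop, B ≤ y t) :
    Tendsto y atTop (𝓝 (κ ^ (1 / (1 - β)))) := by
  have hβ' : 0 < 1 - β := sub_pos.2 hβ
  have hbu : IsBoundedUnder (· ≤ ·) atTop y := ⟨C, hyC⟩
  have hbl : IsBoundedUnder (· ≥ ·) atTop y := ⟨c, hcy⟩
  have hcl : c ≤ liminf y atTop := le_liminf_of_le hbu.isCoboundedUnder_ge hcy
  have hlu : liminf y atTop ≤ limsup y atTop := liminf_le_limsup hbu hbl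
  have hl0 : 0 < liminf y atTop := hc.trans_le hcl
  have hu0 : 0 < limsup y atTop := hl0.trans_le hlu
  have hcont : ∀ l : ℝ, 0 < l → ContinuousAt (fun K : ℝ => κ * K ^ β) l := fun l hl =>
    (Real.continuousAt_rpow_const l β (Or.inl hl.ne')).const_mul κ
  refine tendsto_of_le_liminf_of_limsup_le ?_ ?_ hbu hbl
  · have h1 : κ * (liminf y atTop) ^ β ≤ liminf y atTop := by
      refine le_of_tendsto ((hcont _ hl0).mono_left
        (nhdsWithin_le_nhds (s := Iio (liminf y atTop)))) ?_
      filter_upwards [self_mem_nhdsWithin, nhdsWithin_le_nhds (lt_mem_nhds hl0)] with k hk hk0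
      refine le_of_forall_lt fun B hB => ?_
      obtain ⟨B', h1, h2⟩ := exists_between hB
      exact h1.trans_le (le_liminf_of_le hbu.isCoboundedUnder_ge
        (hL k hk0 ((eventually_lt_of_lt_liminf hk hbl).mono fun _ h => h.le) B' h2))
    rw [one_div, Real.rpow_inv_le_iff_of_pos hκ.le hl0.le hβ', Real.rpow_sub hl0, Real.rpow_one]
    rwa [le_div_iff₀ (Real.rpow_pos_of_pos hl0 _)]
  · have h1 : limsup y atTop ≤ κ * (limsup y atTop) ^ β := by
      refine ge_of_tendsto ((hcont _ hu0).mono_left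
        (nhdsWithin_le_nhds (s := Ioi (limsup y atTop)))) ?_
      filter_upwards [self_mem_nhdsWithin] with k hk
      have hk0 : 0 < k := hu0.trans hk
      refine le_of_forall_gt fun B hB => ?_
      obtain ⟨B', h1, h2⟩ := exists_between hB
      exact (limsup_le_of_le hbl.isCoboundedUnder_le
        (hU k hk0 ((eventually_lt_of_limsup_lt hk hbu).mono fun _ h => h.le) B' h1)).trans_lt h2
    rw [one_div, Real.le_rpow_inv_iff_of_pos hu0.le hκ.le hβ', Real.rpow_sub hu0, Real.rpow_one]
    rwa [div_le_iff₀ (Real.rpow_pos_of_pos hu0 _)]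

/-- Let `x = ξ + M * g` with `g` asymptotic to `φ ∘ x`, and let `a` be a comparison function for
which `M * (φ ∘ a) ~ κ a`. Then `x / a` tends to `κ ^ (1 / (1 - β))`. -/
theorem IsConvolutionSolution.tendsto_div {M φ a g x : ℝ → ℝ} {ξ β κ : ℝ}
    (hV : IsConvolutionSolution M g ξ x) (hξ : 0 ≤ ξ) (hM : Monotone M) (hM0 : ∀ t, 0 ≤ M t)
    (hφ : HasIndex φ β) (hφm : Monotone φ) (hφ0 : ∀ u, 0 < φ u) (hβ0 : 0 ≤ β) (hβ : β < 1)
    (ham : Monotone a) (ha0 : ∀ t, 0 < a t) (ha : Tendsto a atTop atTop)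
    (hx0 : ∀ t, 0 ≤ t → 0 < x t) (hxm : MonotoneOn x (Ici 0)) (hx : Tendsto x atTop atTop)
    (hg : Tendsto (fun u => g u / φ (x u)) atTop (𝓝 1))
    (hMa : Tendsto (fun t => M t / a t) atTop (𝓝 0))
    (hconv : Tendsto (fun t => (∫ u in (0 : ℝ)..t, M (t - u) * φ (a u)) / a t) atTop (𝓝 κ))
    (hκ : 0 < κ) : Tendsto (fun t => x t / a t) atTop (𝓝 (κ ^ (1 / (1 - β)))) := by
  set I : ℝ → ℝ := fun t => ∫ u in (0 : ℝ)..t, M (t - u) * φ (a u) with hI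
  have hhm : Monotone fun u => φ (a u) := hφm.comp ham
  have hh0 : ∀ u, 0 < φ (a u) := fun u => hφ0 _
  -- the two one-sided estimates, after division by `a`
  have hlimU : ∀ G K : ℝ, Tendsto (fun t => (ξ + M t * G + K * I t) / a t) atTop (𝓝 (K * κ)) := by
    intro G K
    have h1 := ((ha.const_div_atTop ξ).add (hMa.mul_const G)).add (hconv.const_mul K)
    rw [zero_mul, zero_add, zero_add] at h1
    exact h1.congr fun t => by ring
  have hlimL : ∀ D : ℝ, Tendsto (fun t => (I t - M t * D) / a t) atTop (𝓝 κ) := by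
    intro D
    have h1 := hconv.sub (hMa.mul_const D)
    rw [zero_mul, sub_zero] at h1
    exact h1.congr fun t => by ring
  obtain ⟨X, C, hX, hC, hP⟩ := hφ.exists_potter (b := (β + 1) / 2) hφm hφ0 (by linarith)
    (by linarith)
  set b := (β + 1) / 2 with hb
  have hb1 : b < 1 := by linarith
  have hC0 : 0 < C := by linarith
  obtain ⟨T, hT⟩ := eventually_atTop.1 ((((hx.eventually_ge_atTop X).and
    (ha.eventually_ge_atTop X)).and ((hg.eventually (gt_mem_nhds one_lt_two)).and
    (hg.eventually (lt_mem_nhds one_half_lt_one)))).and (eventually_ge_atTop 0))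
  have hT0 : 0 ≤ T := (hT T le_rfl).2
  have hxX : ∀ u, T ≤ u → X ≤ x u := fun u hu => (hT u hu).1.1.1
  have haX : ∀ u, T ≤ u → X ≤ a u := fun u hu => (hT u hu).1.1.2
  have hg2 : ∀ u, T ≤ u → g u ≤ 2 * φ (x u) := fun u hu => by
    have := (hT u hu).1.2.1
    rw [div_lt_iff₀ (hφ0 _)] at this
    exact this.le
  have hg1 : ∀ u, T ≤ u → φ (x u) ≤ 2 * g u := fun u hu => by
    have := (hT u hu).1.2.2
    rw [lt_div_iff₀ (hφ0 _)] at this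
    linarith
  -- a priori bounds for `x / a` and `a / x`: by the Potter bound, a bound `s` on the past gives a
  -- bound of order `s ^ b` with `b < 1`
  obtain ⟨K₁, hK₁⟩ : ∃ K, ∀ t, T ≤ t → x t / a t ≤ K := by
    refine exists_bound_of_self_bound (A := 1) (B := 2 * C * (κ + 1)) hb1
      (fun t => ⟨x t / a T, fun u hu => ?_⟩) ?_
    · exact div_le_div₀ (hx0 t (hT0.trans (hu.1.trans hu.2))).le
        (hxm (hT0.trans hu.1) (hT0.trans (hu.1.trans hu.2)) hu.2) (ha0 T) (ham hu.1)
    · have h1 := hlimU (∫ u in (0 : ℝ)..T, g u) 0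
      rw [zero_mul] at h1
      filter_upwards [h1.eventually (gt_mem_nhds one_pos),
        hconv.eventually (gt_mem_nhds (lt_add_one κ)), eventually_ge_atTop T]
        with t h1 h2 ht s hs hs'
      have hs0 : 0 < s := by linarith
      have h3 := hV.le_of_forall_le hM hM0 hhm hh0 hT0 ht (K := 2 * C * s ^ b) (by positivity)
        fun u hu => by
          have h4 := hs' u hu
          rw [div_le_iff₀ (ha0 u)] at h4
          have h5 := hP (x u) (a u) s (haX u hu.1) hs h4
          linarith [hg2 u hu.1]
      rw [zero_mul, add_zero] at h1
      calc x t / a t ≤ (ξ + M t * (∫ u in (0 : ℝ)..T, g u) + 2 * C * s ^ b * I t) / a t :=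
            div_le_div_of_nonneg_right h3 (ha0 t).le
        _ = (ξ + M t * (∫ u in (0 : ℝ)..T, g u)) / a t + 2 * C * s ^ b * (I t / a t) := by ring
        _ ≤ 1 + 2 * C * s ^ b * (κ + 1) := by gcongr
        _ = _ := by ring
  obtain ⟨K₂, hK₂⟩ : ∃ K, ∀ t, T ≤ t → a t / x t ≤ K := by
    refine exists_bound_of_self_bound (A := 0) (B := 4 * C / κ) hb1
      (fun t => ⟨a t / x T, fun u hu => ?_⟩) ?_
    · exact div_le_div₀ (ha0 t).le (ham hu.2) (hx0 T hT0) (hxm hT0 (hT0.trans hu.1) hu.1)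
    · filter_upwards [(hlimL (T * φ (a T))).eventually (lt_mem_nhds (half_lt_self hκ)),
        eventually_ge_atTop T] with t h2 ht s hs hs'
      have hs0 : 0 < s := by linarith
      have hsb : 0 < 2 * C * s ^ b := by positivity
      have h3 := hV.le_of_forall_ge hξ hM hM0 hhm hh0 hT0 ht (k := (2 * C * s ^ b)⁻¹)
        (by positivity) fun u hu => by
          have h4 := hs' u hu
          rw [div_le_iff₀ (hx0 u (hT0.trans hu.1))] at h4
          have h5 := hP (a u) (x u) s (hxX u hu.1) hs h4
          rw [inv_mul_le_iff₀ hsb]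
          calc φ (a u) ≤ C * s ^ b * φ (x u) := h5
            _ ≤ C * s ^ b * (2 * g u) := by gcongr; exact hg1 u hu.1
            _ = _ := by ring
      rw [inv_mul_le_iff₀ hsb] at h3
      rw [lt_div_iff₀ (ha0 t)] at h2
      rw [zero_add, div_le_iff₀ (hx0 t (hT0.trans ht))]
      have h6 : κ * a t ≤ 4 * C * s ^ b * x t := by linarith
      calc a t = κ * a t / κ := by field_simp
        _ ≤ 4 * C * s ^ b * x t / κ := by gcongr
        _ = _ := by ring
  refine tendsto_of_bound_improvement (c := (max K₂ 1)⁻¹) (C := K₁) hβ hκ (by positivity)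
    ?_ ?_ ?_ ?_
  · filter_upwards [eventually_ge_atTop T] with t ht
    rw [inv_le_comm₀ (by positivity) (div_pos (hx0 t (hT0.trans ht)) (ha0 t)), inv_div]
    exact (hK₂ t ht).trans (le_max_left _ _)
  · filter_upwards [eventually_ge_atTop T] with t ht using hK₁ t ht
  · -- `x ≤ K a` eventually implies `g ≤ K' φ(a)` for any `K' > K ^ β`
    intro K hK hyK B hB
    rw [mul_comm, ← lt_div_iff₀ hκ] at hB
    obtain ⟨K', h1, h2⟩ := exists_between hB
    have hK' : 0 < K' := (Real.rpow_pos_of_pos hK β).trans h1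
    have h3 := hg.mul ((hφ K hK).comp ha)
    rw [one_mul] at h3
    obtain ⟨S, hS⟩ := eventually_atTop.1 ((h3.eventually (gt_mem_nhds h1)).and
      (hyK.and (eventually_ge_atTop 0)))
    have hS0 := (hS S le_rfl).2.2
    rw [lt_div_iff₀ hκ] at h2
    filter_upwards [(hlimU (∫ u in (0 : ℝ)..S, g u) K').eventually (gt_mem_nhds h2),
      eventually_ge_atTop S] with t h4 ht
    refine (div_le_div_of_nonneg_right ?_ (ha0 t).le).trans h4.le
    refine hV.le_of_forall_le hM hM0 hhm hh0 hS0 ht hK'.le fun u hu => ?_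
    obtain ⟨h5, h6, -⟩ := hS u hu.1
    rw [div_le_iff₀ (ha0 u)] at h6
    have h7 : 0 ≤ g u / φ (x u) :=
      div_nonneg (hV.nonneg u (hS0.trans hu.1)) (hφ0 _).le
    have h8 : φ (x u) ≤ φ (K * a u) := hφm h6
    calc g u = g u / φ (x u) * φ (x u) := by have := (hφ0 (x u)).ne'; field_simp
      _ ≤ g u / φ (x u) * φ (K * a u) := by gcongr
      _ = (g u / φ (x u) * (φ (K * a u) / φ (a u))) * φ (a u) := by
        have := (hφ0 (a u)).ne'; field_simp
      _ ≤ K' * φ (a u) := mul_le_mul_of_nonneg_right h5.le (hh0 u).le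
  · -- `k a ≤ x` eventually implies `k' φ(a) ≤ g` for any `k' < k ^ β`
    intro k hk hyk B hB
    have hB' : max (B / κ) 0 < k ^ β :=
      max_lt (by rwa [div_lt_iff₀ hκ, mul_comm]) (Real.rpow_pos_of_pos hk β)
    obtain ⟨k', h1, h2⟩ := exists_between hB'
    have hk' : 0 < k' := (le_max_right _ _).trans_lt h1
    replace h1 : B < k' * κ := (div_lt_iff₀ hκ).1 ((le_max_left _ _).trans_lt h1)
    have h3 := hg.mul ((hφ k hk).comp ha)
    rw [one_mul] at h3
    obtain ⟨S, hS⟩ := eventually_atTop.1 ((h3.eventually (lt_mem_nhds h2)).and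
      (hyk.and (eventually_ge_atTop 0)))
    have hS0 := (hS S le_rfl).2.2
    filter_upwards [((hlimL (S * φ (a S))).const_mul k').eventually (lt_mem_nhds h1),
      eventually_ge_atTop S] with t h4 ht
    refine h4.le.trans ?_
    rw [← mul_div_assoc]
    refine div_le_div_of_nonneg_right ?_ (ha0 t).le
    refine hV.le_of_forall_ge hξ hM hM0 hhm hh0 hS0 ht hk'.le fun u hu => ?_
    obtain ⟨h5, h6, -⟩ := hS u hu.1
    rw [le_div_iff₀ (ha0 u)] at h6
    have h7 : 0 ≤ g u / φ (x u) :=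
      div_nonneg (hV.nonneg u (hS0.trans hu.1)) (hφ0 _).le
    have h8 : φ (k * a u) ≤ φ (x u) := hφm h6
    calc k' * φ (a u) ≤ (g u / φ (x u) * (φ (k * a u) / φ (a u))) * φ (a u) :=
          mul_le_mul_of_nonneg_right h5.le (hh0 u).le
      _ = g u / φ (x u) * φ (k * a u) := by have := (hφ0 (a u)).ne'; field_simp
      _ ≤ g u / φ (x u) * φ (x u) := by gcongr
      _ = g u := by have := (hφ0 (x u)).ne'; field_simp

/-! ### The functions `F` and `M̄` -/

section bigF

variable {f : ℝ → ℝ}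

lemma bigF_sub (hf_int : ∀ u : ℝ, 0 < u → IntervalIntegrable (fun v => 1 / f v) volume 1 u)
    {u v : ℝ} (hu : 0 < u) (hv : 0 < v) : bigF f v - bigF f u = ∫ w in u..v, 1 / f w :=
  intervalIntegral.integral_interval_sub_left (hf_int v hv) (hf_int u hu)

lemma strictMonoOn_bigF (hf_pos : ∀ u, 0 < u → 0 < f u)
    (hf_int : ∀ u : ℝ, 0 < u → IntervalIntegrable (fun v => 1 / f v) volume 1 u) :
    StrictMonoOn (bigF f) (Ioi 0) := by
  intro u hu v hv huv
  have hu : 0 < u := hu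
  rw [← sub_pos, bigF_sub hf_int hu hv]
  exact intervalIntegral.intervalIntegral_pos_of_pos_on ((hf_int u hu).symm.trans (hf_int v hv))
    (fun w hw => one_div_pos.2 (hf_pos w (hu.trans hw.1))) huv

variable {φ : ℝ → ℝ} {β : ℝ}

lemma tendsto_bigF (hφ : HasIndex φ β) (hmono : Monotone φ) (hpos : ∀ u, 0 < φ u) (hβ0 : 0 ≤ β)
    (hβ : β < 1) (hF : Tendsto (fun u => bigF f u * (φ u / u)) atTop (𝓝 (1 / (1 - β)))) :
    Tendsto (bigF f) atTop atTop := by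
  have h1 : Tendsto (fun u => (φ u / u)⁻¹) atTop atTop := by
    refine Tendsto.inv_tendsto_nhdsGT_zero (tendsto_nhdsWithin_iff.2
      ⟨hφ.tendsto_div_self hmono hpos hβ0 hβ, ?_⟩)
    filter_upwards [eventually_gt_atTop 0] with u hu using div_pos (hpos u) hu
  refine (hF.pos_mul_atTop (one_div_pos.2 (sub_pos.2 hβ)) h1).congr' ?_
  filter_upwards [eventually_gt_atTop 0] with u hu
  exact mul_inv_cancel_right₀ (div_pos (hpos u) hu).ne' _

lemma hasIndex_bigF (hφ : HasIndex φ β) (hpos : ∀ u, 0 < φ u) (hβ : β < 1)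
    (hF : Tendsto (fun u => bigF f u * (φ u / u)) atTop (𝓝 (1 / (1 - β)))) :
    HasIndex (bigF f) (1 - β) := by
  have hβ' : (1 : ℝ) - β ≠ 0 := (sub_pos.2 hβ).ne'
  have h1 : HasIndex (fun u => u / φ u) (1 - β) := by
    intro c hc
    rw [Real.rpow_sub hc, Real.rpow_one]
    refine ((tendsto_const_nhds (x := c)).div (hφ c hc) (Real.rpow_pos_of_pos hc _).ne').congr' ?_
    filter_upwards [eventually_gt_atTop 0] with u hu
    have h1 := (hpos u).ne'
    have h2 := (hpos (c * u)).ne'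
    rw [Pi.div_apply]
    field_simp
  refine h1.congr hβ' ?_ ?_
  · have h2 := hF.inv₀ (one_div_ne_zero hβ')
    rw [one_div, inv_inv] at h2
    refine h2.congr fun u => ?_
    rw [mul_inv, inv_div, mul_comm]
    rfl
  · filter_upwards [eventually_gt_atTop 0] with u hu using div_pos hu (hpos u)

/-- A monotone right inverse of `bigF f` on `[0, ∞)`, with values in `[1, ∞)`. -/
lemma exists_bigF_inverse (hf_pos : ∀ u, 0 < u → 0 < f u)
    (hf_int : ∀ u : ℝ, 0 < u → IntervalIntegrable (fun v => 1 / f v) volume 1 u)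
    (hF : Tendsto (bigF f) atTop atTop) :
    ∃ A : ℝ → ℝ, Monotone A ∧ (∀ s, 1 ≤ A s) ∧ ∀ s, 0 ≤ s → bigF f (A s) = s := by
  have hsm := strictMonoOn_bigF hf_pos hf_int
  have hex : ∀ s, ∃ u, 1 ≤ u ∧ bigF f u = max s 0 := by
    intro s
    obtain ⟨U, hU, hU1⟩ := ((hF.eventually_ge_atTop (max s 0)).and (eventually_ge_atTop 1)).exists
    have hcont : ContinuousOn (bigF f) (Icc 1 U) := by
      have := intervalIntegral.continuousOn_primitive_interval'
        (hf_int U (by linarith)) left_mem_uIcc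
      rwa [uIcc_of_le hU1] at this
    have h1 : bigF f 1 = 0 := intervalIntegral.integral_same
    obtain ⟨u, hu, hu'⟩ := intermediate_value_Icc hU1 hcont
      ⟨by rw [h1]; exact le_max_right _ _, hU⟩
    exact ⟨u, hu.1, hu'⟩
  choose A hA1 hA using hex
  refine ⟨A, fun s t hst => ?_, hA1, fun s hs => by rw [hA, max_eq_left hs]⟩
  rw [← hsm.le_iff_le (mem_Ioi.2 (one_pos.trans_le (hA1 s)))
    (mem_Ioi.2 (one_pos.trans_le (hA1 t))), hA, hA]
  exact max_le_max_right _ hst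

end bigF

section cumMassIntegral

variable {μ : Measure ℝ} {θ : ℝ}

lemma cumMassIntegral_mono (hμ : ∀ t : ℝ, μ (Icc 0 t) < ⊤) : Monotone (cumMassIntegral μ) := by
  intro s t hst
  have hi : ∀ a b, IntervalIntegrable (cumMass μ) volume a b := fun a b =>
    (cumMass_mono hμ).intervalIntegrable
  have h1 : cumMassIntegral μ t - cumMassIntegral μ s = ∫ u in s..t, cumMass μ u :=
    intervalIntegral.integral_interval_sub_left (hi 0 t) (hi 0 s)
  have h2 := intervalIntegral.integral_nonneg (μ := volume) hst fun u _ => cumMass_nonneg μ u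
  linarith

/-- Karamata's theorem for the integral of `M`: convolution with a constant. -/
lemma tendsto_cumMassIntegral_div (hμ : ∀ t : ℝ, μ (Icc 0 t) < ⊤) (hμ_inf : μ (Ici 0) = ⊤)
    (hθ : 0 ≤ θ) (hM : HasIndex (cumMass μ) θ) :
    Tendsto (fun t => cumMassIntegral μ t / (t * cumMass μ t)) atTop (𝓝 (1 / (θ + 1))) := by
  have h1 := tendsto_convolution_div (h := fun _ => 1) (γ := 0) (cumMass_mono hμ)
    (cumMass_nonneg μ) ((tendsto_cumMass hμ hμ_inf).eventually_gt_atTop 0) hM hθ monotone_const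
    (fun _ => one_pos) (fun c _ => by simp) le_rfl
  have h2 : ProbabilityTheory.beta (θ + 1) (0 + 1) = 1 / (θ + 1) := by
    have : Real.Gamma (θ + 1) ≠ 0 := (Real.Gamma_pos_of_pos (by linarith)).ne'
    have h3 : θ + 1 ≠ 0 := by linarith
    rw [ProbabilityTheory.beta, zero_add, Real.Gamma_one, Real.Gamma_add_one h3]
    field_simp
  rw [h2] at h1
  refine h1.congr fun t => ?_
  simp only [mul_one]
  rw [intervalIntegral.integral_comp_sub_left (fun u => cumMass μ u), sub_self, sub_zero]
  rfl

lemma tendsto_cumMassIntegral (hμ : ∀ t : ℝ, μ (Icc 0 t) < ⊤) (hμ_inf : μ (Ici 0) = ⊤)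
    (hθ : 0 ≤ θ) (hM : HasIndex (cumMass μ) θ) : Tendsto (cumMassIntegral μ) atTop atTop := by
  have h1 := tendsto_cumMass hμ hμ_inf
  refine ((tendsto_cumMassIntegral_div hμ hμ_inf hθ hM).pos_mul_atTop
    (one_div_pos.2 (by linarith)) (tendsto_id.atTop_mul_atTop₀ h1)).congr' ?_
  filter_upwards [eventually_gt_atTop 0, h1.eventually_gt_atTop 0] with t ht hMt
  exact div_mul_cancel₀ _ (mul_pos ht hMt).ne'

lemma hasIndex_cumMassIntegral (hμ : ∀ t : ℝ, μ (Icc 0 t) < ⊤) (hμ_inf : μ (Ici 0) = ⊤)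
    (hθ : 0 ≤ θ) (hM : HasIndex (cumMass μ) θ) : HasIndex (cumMassIntegral μ) (1 + θ) := by
  have hθ' : θ + 1 ≠ 0 := by linarith
  have h1 : HasIndex (fun t => t * cumMass μ t) (1 + θ) := by
    intro c hc
    rw [Real.rpow_add hc, Real.rpow_one]
    refine ((hM c hc).const_mul c).congr' ?_
    filter_upwards [eventually_gt_atTop 0] with t ht
    rw [mul_assoc, ← mul_div_assoc c, ← mul_div_mul_left _ _ ht.ne']
    ring_nf
  refine h1.congr hθ' ?_ ?_
  · have h2 := (tendsto_cumMassIntegral_div hμ hμ_inf hθ hM).inv₀ (one_div_ne_zero hθ')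
    rw [one_div, inv_inv] at h2
    exact h2.congr fun t => inv_div _ _
  · filter_upwards [eventually_gt_atTop 0,
      (tendsto_cumMass hμ hμ_inf).eventually_gt_atTop 0] with t ht hMt using mul_pos ht hMt

end cumMassIntegral

lemma Lam_pos {β θ : ℝ} (hβ0 : 0 ≤ β) (hβ : β < 1) (hθ : 0 ≤ θ) : 0 < Lam β θ := by
  have : 0 < 1 - β := sub_pos.2 hβ
  exact div_pos (mul_pos (Real.Gamma_pos_of_pos (by positivity))
    (Real.Gamma_pos_of_pos (by positivity))) (Real.Gamma_pos_of_pos (by positivity))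

lemma beta_mul_eq_Lam {β θ : ℝ} (hβ : β < 1) (hθ : 0 ≤ θ) :
    ProbabilityTheory.beta (θ + 1) ((1 + θ) / (1 - β) * β + 1) * ((1 + θ) / (1 - β))
      = Lam β θ := by
  have h1 : 0 < 1 - β := sub_pos.2 hβ
  have h2 : 0 < (1 + θ) / (1 - β) := by positivity
  have e1 : (1 + θ) / (1 - β) * β + 1 = (1 + β * θ) / (1 - β) := by field_simp; ring
  have e2 : θ + 1 + (1 + β * θ) / (1 - β) = (1 + θ) / (1 - β) + 1 := by field_simp; ring
  have h3 := (Real.Gamma_pos_of_pos h2).ne'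
  rw [ProbabilityTheory.beta, Lam, e1, e2, Real.Gamma_add_one h2.ne']
  field_simp

end VolterraRV

theorem theorem2p1
    (μ : Measure ℝ) (hμ_fin : ∀ t : ℝ, μ (Icc 0 t) < ⊤) (hμ_inf : μ (Ici 0) = ⊤)
    (θ : ℝ) (hθ : 0 ≤ θ) (hM : VolterraRV.RegularlyVarying (VolterraRV.cumMass μ) θ)
    (f : ℝ → ℝ) (hf_meas : Measurable f) (hf_pos : ∀ u : ℝ, 0 < u → 0 < f u)
    (hf_int : ∀ u : ℝ, 0 < u → IntervalIntegrable (fun v => 1 / f v) volume 1 u)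
    (β : ℝ) (hβ0 : 0 ≤ β) (hβ1 : β < 1) (hf : VolterraRV.RegularlyVarying f β)
    (hf0 : β = 0 → VolterraRV.AsymptoticallyIncreasing f ∧ Tendsto f atTop atTop)
    (ξ : ℝ) (hξ : 0 < ξ) (x : ℝ → ℝ) (hx : VolterraRV.IsSolution μ f ξ x) :
    VolterraRV.RegularlyVarying x ((1 + θ) / (1 - β)) ∧
      Tendsto (fun t => VolterraRV.bigF f (x t) / VolterraRV.cumMassIntegral μ t) atTop
        (𝓝 (VolterraRV.Lam β θ)) := by
  open VolterraRV in
  have hMi : HasIndex (cumMass μ) θ := hM.2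
  have hfi : HasIndex f β := hf.2
  have hβ' : 0 < 1 - β := sub_pos.2 hβ1
  have hinc : AsymptoticallyIncreasing f := by
    rcases hβ0.eq_or_lt with h | h
    · exact (hf0 h.symm).1
    · exact hfi.asymptoticallyIncreasing hf_meas hf_pos h
  obtain ⟨φ, hφm, hφ0, hfφ⟩ := hinc.exists_pos hf_pos
  have hφ : HasIndex φ β := hfi.congr one_ne_zero hfφ
    ((eventually_gt_atTop 0).mono fun u hu => hf_pos u hu)
  have hFφ := tendsto_bigF_mul_div hf_meas hf_pos hf_int hfφ hφ hφm hφ0 hβ0 hβ1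
  have hFtop := tendsto_bigF hφ hφm hφ0 hβ0 hβ1 hFφ
  have hFi := hasIndex_bigF hφ hφ0 hβ1 hFφ
  have hFm := (strictMonoOn_bigF hf_pos hf_int).monotoneOn
  have hFpos := hFtop.eventually_gt_atTop 0
  have hMtop := tendsto_cumMass hμ_fin hμ_inf
  have hNtop := tendsto_cumMassIntegral hμ_fin hμ_inf hθ hMi
  have hNi := hasIndex_cumMassIntegral hμ_fin hμ_inf hθ hMi
  have hNM := tendsto_cumMassIntegral_div hμ_fin hμ_inf hθ hMi
  -- the comparison function `a = F⁻¹ ∘ M̄`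
  obtain ⟨A, hAm, hA1, hA⟩ := exists_bigF_inverse hf_pos hf_int hFtop
  set a : ℝ → ℝ := fun t => A (cumMassIntegral μ t) with ha_def
  have ham : Monotone a := hAm.comp (cumMassIntegral_mono hμ_fin)
  have ha0 : ∀ t, 0 < a t := fun t => one_pos.trans_le (hA1 _)
  have hFa : ∀ᶠ t in atTop, bigF f (a t) = cumMassIntegral μ t := by
    filter_upwards [hNtop.eventually_ge_atTop 0] with t ht using hA _ ht
  have hatop : Tendsto a atTop atTop := by
    refine tendsto_atTop.2 fun K => ?_
    filter_upwards [hNtop.eventually_gt_atTop (bigF f (max K 1)), hFa] with t h1 h2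
    by_contra! hcon
    rw [← h2] at h1
    exact absurd (hFm (ha0 t) (mem_Ioi.2 (by positivity)) (hcon.le.trans (le_max_left _ _)))
      h1.not_ge
  have hai : HasIndex a ((1 + θ) / (1 - β)) := by
    intro c hc
    have hc' : Tendsto (fun t : ℝ => c * t) atTop atTop := tendsto_id.const_mul_atTop hc
    have h1 := hFi.tendsto_div_of_comp hβ' hFm hFpos (p := fun t => a (c * t)) (q := a)
      (Real.rpow_pos_of_pos hc (1 + θ)) hatop (Eventually.of_forall fun t => ha0 _)
      ((hNi c hc).congr' (by
        filter_upwards [hFa, hc'.eventually hFa] with t h1 h2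
        rw [h1, h2]))
    rwa [← Real.rpow_mul hc.le, mul_one_div] at h1
  have hhi : HasIndex (fun t => φ (a t)) ((1 + θ) / (1 - β) * β) := by
    intro c hc
    rw [Real.rpow_mul hc.le]
    exact hφ.tendsto_comp_div (hφm.monotoneOn _) (Eventually.of_forall hφ0)
      (Real.rpow_pos_of_pos hc _) hatop (hai c hc)
  -- `a` satisfies the relation `t M φ(a) ~ ρ a` with `ρ = (1 + θ) / (1 - β)`
  have hat : Tendsto (fun t => t * cumMass μ t * φ (a t) / a t) atTop
      (𝓝 ((1 + θ) / (1 - β))) := by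
    have h1 := (hFφ.comp hatop).div hNM (one_div_pos.2 (by linarith : 0 < θ + 1)).ne'
    rw [show 1 / (1 - β) / (1 / (θ + 1)) = (1 + θ) / (1 - β) by rw [add_comm]; field_simp] at h1
    refine h1.congr' ?_
    filter_upwards [hFa, hNtop.eventually_gt_atTop 0, eventually_gt_atTop 0,
      hMtop.eventually_gt_atTop 0] with t h1 h2 h3 h4
    simp only [Pi.div_apply, Function.comp]
    rw [h1]
    have := (ha0 t).ne'
    field_simp
  have hMa : Tendsto (fun t => cumMass μ t / a t) atTop (𝓝 0) := by
    have h1 := (hat.mul_const (φ 1)⁻¹).mul tendsto_inv_atTop_zero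
    rw [mul_zero] at h1
    refine squeeze_zero' (Eventually.of_forall fun t =>
      div_nonneg (cumMass_nonneg μ t) (ha0 t).le) ?_ h1
    filter_upwards [eventually_gt_atTop 0] with t ht
    have h2 : 1 ≤ φ (a t) * (φ 1)⁻¹ := by
      rw [← div_eq_mul_inv, one_le_div (hφ0 1)]
      exact hφm (hA1 _)
    calc cumMass μ t / a t ≤ cumMass μ t / a t * (φ (a t) * (φ 1)⁻¹) :=
          le_mul_of_one_le_right (div_nonneg (cumMass_nonneg μ t) (ha0 t).le) h2
      _ = _ := by field_simp
  have hconv : Tendsto (fun t => (∫ u in (0 : ℝ)..t, cumMass μ (t - u) * φ (a u)) / a t) atTop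
      (𝓝 (Lam β θ)) := by
    have h1 := (tendsto_convolution_div (cumMass_mono hμ_fin) (cumMass_nonneg μ)
      (hMtop.eventually_gt_atTop 0) hMi hθ (hφm.comp ham) (fun t => hφ0 _) hhi
      (by positivity)).mul hat
    rw [beta_mul_eq_Lam hβ1 hθ] at h1
    refine h1.congr' ?_
    filter_upwards [eventually_gt_atTop 0, hMtop.eventually_gt_atTop 0] with t h1 h2
    have h3 : t * cumMass μ t * φ (a t) ≠ 0 := (mul_pos (mul_pos h1 h2) (hφ0 _)).ne'
    exact div_mul_div_cancel₀ h3
  have hL := Lam_pos hβ0 hβ1 hθ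
  have hxtop := hx.tendsto_atTop hμ_fin hμ_inf hf_meas hf_pos hξ
  have hxa := (hx.isConvolutionSolution hμ_fin hμ_inf hf_meas hf_pos).tendsto_div hξ.le
    (cumMass_mono hμ_fin) (cumMass_nonneg μ) hφ hφm hφ0 hβ0 hβ1 ham ha0 hatop hx.pos
    (hx.monotoneOn hf_pos) hxtop (hfφ.comp hxtop) hMa hconv hL
  have hLpos : 0 < Lam β θ ^ (1 / (1 - β)) := Real.rpow_pos_of_pos hL _
  refine ⟨⟨⟨0, hx.pos, hx.continuousOn.domRestrict.measurable⟩, ?_⟩, ?_⟩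
  · refine hai.congr (inv_ne_zero hLpos.ne') ?_ (Eventually.of_forall ha0)
    exact (hxa.inv₀ hLpos.ne').congr fun t => inv_div _ _
  · have h1 := hFi.tendsto_comp_div hFm hFpos hLpos hatop hxa
    rw [← Real.rpow_mul hL.le, one_div_mul_cancel hβ'.ne', Real.rpow_one] at h1
    refine h1.congr' ?_
    filter_upwards [hFa] with t ht
    rw [ht]
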